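/- Let $\theta,\kappa$ be infinite regular cardinals such that $\lambda^\theta<\kappa$ for all cardinals $\lambda<\kappa$. Let $\mathbf X=\langle X_\xi\mid\xi<\zeta\rangle$ be a $\subseteq$-decreasing sequence of nonempty subsets of $\theta$ with $|\theta\setminus X_0|=\theta$ and $\bigcap_{\xi<\zeta}X_\xi=\emptyset$, and let $\mathcal F=\{Y\subseteq\theta\mid\exists\xi<\zeta\,(X_\xi\subseteq Y)\}$. *Trees.* A tree is a set $T\subseteq{}^{<\kappa}\kappa$ closed under initial segments; $T_\alpha$ is the set of its nodes with domain $\alpha$, and its height is the least $\alpha$ with $T_\alpha=\emptyset$. $T$ is normal if for all $x\in T$ and $\alpha$ below the height of $T$ there is $y\in T_\alpha$ with $x\subseteq y$ or $y\subseteq x$. $T$ is uniformly homogeneous if $s*t\in T$ for all $s,t\in T$, where $s*t$ is the function with domain $\mathrm{dom}(t)$ that agrees with $s$ on $\mathrm{dom}(s)\cap\mathrm{dom}(t)$ and with $t$ elsewhere. $V(T)$ is the set of nonzero limit ordinals $\alpha<\kappa$ such that every $x\in T$ with $\mathrm{dom}(x)<\alpha$ is an initial segment of some $b:\alpha\to\kappa$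 with $b\notin T$ all of whose proper initial segments are in $T$. Nodes $s,t$ are mutually exclusive if $s(\varepsilon)\ne t(\varepsilon)$ for all $\varepsilon\in\mathrm{dom}(s)\cap\mathrm{dom}(t)$. For $f,g$ mapping $\theta$ to nodes, $\mathrm{supp}(f,g)=\{\tau<\theta\mid f(\tau)\subseteq g(\tau)\text{ or }g(\tau)\subseteq f(\tau)\}$. *The poset $\mathbb S^\kappa_{\mathbf X}$.* Its conditions are the pairs $\langle T,\vec f\rangle$ such that, for some $\eta<\kappa$: $T$ is a normal uniformly homogeneous tree of height $\eta+1$ all of whose levels have size less than $\kappa$; $\vec f=\langle \vec f(\alpha)\mid\alpha\le\eta\rangle$ with $\vec f(\alpha):\theta\to T_\alpha$, with $\mathrm{supp}(\vec f(\alpha),\vec f(\beta))\in\mathcal F$ for $\alpha<\beta\le\eta$, and, for nonzero $\alpha\le\eta$, with the nodes $\vec f(\alpha)(\tau)$, $\tau<\theta$, pairwise mutually exclusive; $V(T)$ is closed, and $\eta\in V(T)$ if $\eta$ is a nonzero limit ordinal; for every nonzero $\alpha\le\eta$ and $t\in T_\alpha$, $\{\tau<\theta\mid t\text{ and }\vec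 f(\alpha)(\tau)\text{ are mutually exclusive}\}\in\mathcal F$. The order is end-extension in both coordinates. *The posets $\mathbb A$.* For an $\mathbb S^\kappa_{\mathbf X}$-generic filter $G$ let $\vec{f^G}=\bigcup\{\vec f\mid\langle T,\vec f\rangle\in G\}$. In $V[G]$, for $\xi<\zeta$, $\mathbb A^\kappa_{\mathbf X,\xi}$ is the poset with underlying set $\kappa$ in which $\beta\le_{\mathbb A^\kappa_{\mathbf X,\xi}}\alpha$ iff $\alpha\le\beta$ and $X_\xi\subseteq\mathrm{supp}(\vec{f^G}(\alpha),\vec{f^G}(\beta))$, and $\mathbb A^\kappa_{\mathbf X}$ is the lottery sum of these posets over $\xi<\zeta$ (their disjoint sum with a new largest element). A poset has the $\kappa$-chain condition if each of its antichains (sets of pairwise incompatible elements) has size less than $\kappa$. **Lemma.** For every $\xi<\zeta$, $\mathbb S^\kappa_{\mathbf X}\Vdash$ "$\dot{\mathbb A}^\kappa_{\mathbf X,\xi}$ has the $\kappa$-chain condition". Moreover, if the sequence $\mathbf X$ is strictly decreasing, or, more generally, if $\zeta<\theta^+$, then $\mathbb S^\kappa_{\mathbf X}\Vdash$ "$\dot{\mathbb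 A}^\kappa_{\mathbf X}$ has the $\kappa$-chain condition". -/

import Mathlib

universe u

section Forcing

/-! Forcing over an arbitrary preorder: names, the forcing relation, and the few set-theoretic
formulas that are needed. Smaller conditions are stronger. -/

/-- `P`-names: a name is a (small) set of pairs `(elt i, cond i)` of a name and a condition. -/
inductive PName (P : Type u) : Type (u + 1)
  | mk (ι : Type u) (elt : ι → PName P) (cond : ι → P) : PName P

/-- A sentence of the forcing language over `P` is given by the set of conditions forcing it.
Sentences are only ever formed by the standard clauses below. -/
abbrev FSent (P : Type u) : Type u := P → Prop

variable {P : Type u} [Preorder P]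

namespace FSent

/-- `p ⊩ φ ∧ ψ`. -/
def and (φ ψ : FSent P) : FSent P := fun p => φ p ∧ ψ p

/-- `p ⊩ ¬ φ`. -/
def neg (φ : FSent P) : FSent P := fun p => ∀ q ≤ p, ¬ φ q

/-- `p ⊩ φ → ψ`. -/
def imp (φ ψ : FSent P) : FSent P := fun p => ∀ q ≤ p, φ q → ψ q

/-- `p ⊩ φ ∨ ψ`. -/
def or (φ ψ : FSent P) : FSent P := fun p => ∀ q ≤ p, ∃ r ≤ q, φ r ∨ ψ r

/-- `p ⊩ ∀ x, φ x`, where `x` ranges over all names or over a set of the ground model. -/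
def all {I : Sort*} (φ : I → FSent P) : FSent P := fun p => ∀ x, φ x p

/-- `p ⊩ ∃ x, φ x`, where `x` ranges over all names or over a set of the ground model. -/
def ex {I : Sort*} (φ : I → FSent P) : FSent P := fun p => ∀ q ≤ p, ∃ r ≤ q, ∃ x, φ x r

end FSent

/-- `φ` is forced (by every condition): `P ⊩ φ`. -/
def Forced (φ : FSent P) : Prop := ∀ p, φ p

namespace PName

/-- The index set of the pairs that make up a name. -/
def idx : PName P → Type u
  | mk ι _ _ => ι

/-- The name in the `i`-th pair. -/
def elt : (x : PName P) → x.idx → PName P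
  | mk _ a _ => a

/-- The condition in the `i`-th pair. -/
def cnd : (x : PName P) → x.idx → P
  | mk _ _ c => c

/-- `p ⊩ x = y`: whenever a condition below `p` puts an element into `x`, it forces that element
to be a member of `y` (see below), and vice versa. -/
def eq : PName P → PName P → FSent P
  | mk _ a c, mk _ b d => fun p =>
      (∀ i, ∀ q ≤ p, q ≤ c i → ∀ r ≤ q, ∃ s ≤ r, ∃ j, s ≤ d j ∧ eq (a i) (b j) s) ∧
      (∀ j, ∀ q ≤ p, q ≤ d j → ∀ r ≤ q, ∃ s ≤ r, ∃ i, s ≤ c i ∧ eq (a i) (b j) s)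

/-- `p ⊩ x ∈ y`: densely below `p`, a condition puts into `y` an element that it forces to be
equal to `x`. -/
def mem (x : PName P) : PName P → FSent P
  | mk _ b d => fun p => ∀ q ≤ p, ∃ r ≤ q, ∃ j, r ≤ d j ∧ eq x (b j) r

/-- `∀ x ∈ y, φ x`. -/
def ballIn (y : PName P) (φ : PName P → FSent P) : FSent P :=
  FSent.all fun x => FSent.imp (mem x y) (φ x)

/-- `∃ x ∈ y, φ x`. -/
def bexIn (y : PName P) (φ : PName P → FSent P) : FSent P :=
  FSent.ex fun x => FSent.and (mem x y) (φ x)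

/-- `x ⊆ y`. -/
def sub (x y : PName P) : FSent P := ballIn x fun z => mem z y

/-- The name of the set `{x i | i ∈ I}`, for a family of names indexed in the ground model. -/
def ofFamily {I : Type u} (x : I → PName P) : PName P :=
  mk (I × P) (fun i => x i.1) (fun i => i.2)

/-- The name of the unordered pair `{x, y}`. -/
def upair (x y : PName P) : PName P :=
  ofFamily fun b : ULift.{u} Bool => if b.down then x else y

/-- The name of the (Kuratowski) ordered pair `(x, y)`. -/
def opair (x y : PName P) : PName P := upair (upair x x) (upair x y)

/-- The name of the empty set. -/
def empty : PName P := ofFamily fun i : PEmpty.{u + 1} => i.elim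

/-- The canonical name of the von Neumann ordinal that is the position of `i` in the
well-order `I`. -/
def ofOrd {I : Type u} [LinearOrder I] [WellFoundedLT I] (i : I) : PName P :=
  ofFamily fun j : Set.Iio i => ofOrd j.1
termination_by (wellFounded_lt (α := I)).wrap i
decreasing_by exact j.2

/-- The canonical name of a set `S` of elements of a well-order, seen as a set of ordinals. -/
def ofOrdSet {I : Type u} [LinearOrder I] [WellFoundedLT I] (S : Set I) : PName P :=
  ofFamily fun i : S => ofOrd i.1

/-- The canonical name of the order type of a well-order (an ordinal). -/
def ofType (I : Type u) [LinearOrder I] [WellFoundedLT I] : PName P :=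
  ofOrdSet (Set.univ : Set I)

/-- "`|A| < κ`", for an ordinal `κ`: there is an injective function from `A` to some `μ ∈ κ`. -/
def cardLT (A κ : PName P) : FSent P :=
  bexIn κ fun μ => FSent.ex fun F : PName P =>
    FSent.and (ballIn A fun a => bexIn μ fun b => mem (opair a b) F) <|
    FSent.and
      (ballIn A fun a => FSent.all fun b => FSent.all fun b' =>
        FSent.imp (mem (opair a b) F) (FSent.imp (mem (opair a b') F) (eq b b')))
      (ballIn A fun a => ballIn A fun a' => FSent.all fun b =>
        FSent.imp (mem (opair a b) F) (FSent.imp (mem (opair a' b) F) (eq a a')))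

end PName

/-- A poset of the forcing extension: its underlying set, and its ordering relation
(`le x y` says `x ≤ y`, i.e. `x` is stronger) given by a formula. -/
structure PosetName (P : Type u) where
  carrier : PName P
  le : PName P → PName P → FSent P

namespace PosetName

/-- "`a` and `b` are compatible in `Q`". -/
def compat (Q : PosetName P) (a b : PName P) : FSent P :=
  PName.bexIn Q.carrier fun c => FSent.and (Q.le c a) (Q.le c b)

/-- "`A` is an antichain in `Q`": a subset consisting of pairwise incompatible elements. -/
def isAntichain (Q : PosetName P) (A : PName P) : FSent P :=
  FSent.and (PName.sub A Q.carrier) <|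
    PName.ballIn A fun a => PName.ballIn A fun b =>
      FSent.or (PName.eq a b) (FSent.neg (Q.compat a b))

/-- "`Q` has the `κ`-chain condition": all antichains have size less than `κ`. -/
def hasCC (Q : PosetName P) (κ : PName P) : FSent P :=
  FSent.all fun A : PName P => FSent.imp (Q.isAntichain A) (PName.cardLT A κ)

/-- The lottery sum of a sequence of posets indexed by (the ordinal) `I`: the disjoint sum,
consisting of the pairs `(ξ, a)` with `a ∈ Q ξ`, together with a new largest element `∅`. -/
def lottery {I : Type u} [LinearOrder I] [WellFoundedLT I] (Q : I → PosetName P) :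
    PosetName P where
  carrier := PName.mk ((Σ ξ : I, (Q ξ).carrier.idx) ⊕ P)
    (Sum.elim (fun i => PName.opair (PName.ofOrd i.1) ((Q i.1).carrier.elt i.2))
      (fun _ => PName.empty))
    (Sum.elim (fun i => (Q i.1).carrier.cnd i.2) id)
  le := fun x y => FSent.or (PName.eq y PName.empty) <|
    FSent.ex fun ξ : I => FSent.ex fun a => FSent.ex fun b =>
      FSent.and (PName.eq x (PName.opair (PName.ofOrd ξ) a)) <|
      FSent.and (PName.eq y (PName.opair (PName.ofOrd ξ) b)) ((Q ξ).le a b)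

end PosetName
end Forcing

section Trees

/-! In this section `K` stands for (the well-order of the ordinals below) a cardinal `κ`. -/

/-- An element of `^{<κ}κ`: a function from an ordinal `dom < κ` to `κ`. -/
structure Node (K : Type u) [LinearOrder K] : Type u where
  dom : K
  val : ∀ ε : K, ε < dom → K

variable {K : Type u} [LinearOrder K]

namespace Node

/-- `s ⊆ t`, as functions. -/
def Sub (s t : Node K) : Prop :=
  s.dom ≤ t.dom ∧ ∀ ε (hs : ε < s.dom) (ht : ε < t.dom), s.val ε hs = t.val ε ht

/-- `s` and `t` are mutually exclusive: they disagree wherever both are defined. -/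
def Excl (s t : Node K) : Prop :=
  ∀ ε (hs : ε < s.dom) (ht : ε < t.dom), s.val ε hs ≠ t.val ε ht

/-- `s * t`: the function on `dom t` that agrees with `s` on `dom s`, and with `t` elsewhere. -/
def star (s t : Node K) : Node K where
  dom := t.dom
  val := fun ε ht => if hs : ε < s.dom then s.val ε hs else t.val ε ht

end Node

/-- `T` is a (streamlined) tree: it is closed under initial segments. -/
def IsTree (T : Set (Node K)) : Prop := ∀ t ∈ T, ∀ s : Node K, s.Sub t → s ∈ T

/-- The level `T_α`. -/
def treeLevel (T : Set (Node K)) (α : K) : Set (Node K) := {t | t ∈ T ∧ t.dom = α}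

/-- `T` has height `η + 1`: level `η` is the last nonempty one. -/
def HasTopLevel (T : Set (Node K)) (η : K) : Prop :=
  (treeLevel T η).Nonempty ∧ ∀ t ∈ T, t.dom ≤ η

/-- A tree of height `η + 1` is normal. -/
def IsNormalTree (T : Set (Node K)) (η : K) : Prop :=
  ∀ x ∈ T, ∀ α ≤ η, ∃ y ∈ treeLevel T α, x.Sub y ∨ y.Sub x

/-- `T` is uniformly homogeneous. -/
def IsUnifHomogeneous (T : Set (Node K)) : Prop := ∀ s ∈ T, ∀ t ∈ T, s.star t ∈ T

/-- For a limit `α`, an `α`-branch of `T` is identified with its union `b`, a function with domain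
`α` all of whose proper initial segments are in `T`. It is vanishing if `b` is not in `T`. -/
def IsVanishingBranch (T : Set (Node K)) (α : K) (b : Node K) : Prop :=
  b.dom = α ∧ (∀ s : Node K, s.Sub b → s.dom < α → s ∈ T) ∧ b ∉ T

/-- `V(T)`: the set of the nonzero limit ordinals `α` such that every node of height less than `α`
belongs to a vanishing `α`-branch. -/
def vanishingLevels (T : Set (Node K)) : Set K :=
  {α | Order.IsSuccLimit α ∧ ∀ x ∈ T, x.dom < α → ∃ b, IsVanishingBranch T α b ∧ x.Sub b}

/-- A set of ordinals contains all of its limit points (below `κ`). -/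
def IsClosedOrd (C : Set K) : Prop :=
  ∀ α : K, Order.IsSuccLimit α → (∀ β < α, ∃ γ ∈ C, β < γ ∧ γ < α) → α ∈ C

variable {Θ Z : Type u}

/-- `supp(f, g)`. -/
def nodeSupp (f g : Θ → Node K) : Set Θ := {τ | (f τ).Sub (g τ) ∨ (g τ).Sub (f τ)}

/-- The filter generated by the sets `X ξ`. -/
def GenBy (X : Z → Set Θ) : Set (Set Θ) := {Y | ∃ ξ, X ξ ⊆ Y}

/-- `f` is a mutually exclusive `F`-ascent path through the tree `T` of height `η + 1`. -/
structure IsExclAscentPath (F : Set (Set Θ)) (T : Set (Node K)) (η : K)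
    (f : Set.Iic η → Θ → Node K) : Prop where
  level : ∀ (α : Set.Iic η) (τ : Θ), f α τ ∈ treeLevel T α.1
  ascent : ∀ α β : Set.Iic η, α < β → nodeSupp (f α) (f β) ∈ F
  excl : ∀ α : Set.Iic η, ¬ IsMin α.1 → ∀ τ τ', τ ≠ τ' → (f α τ).Excl (f α τ')

/-- The forcing `S^κ_X`. A condition is a pair `(T, f)`; the ordinal `η` such that `T` has height
`η + 1` is determined by `T`. -/
structure SForcing (K : Type u) [LinearOrder K] {Θ Z : Type u} (X : Z → Set Θ) : Type u where
  T : Set (Node K)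
  η : K
  f : Set.Iic η → Θ → Node K
  tree : IsTree T
  height : HasTopLevel T η
  normal : IsNormalTree T η
  homogeneous : IsUnifHomogeneous T
  narrow : ∀ α : K, Cardinal.mk (treeLevel T α) < Cardinal.mk K
  path : IsExclAscentPath (GenBy X) T η f
  closed : IsClosedOrd (vanishingLevels T)
  top_vanishing : Order.IsSuccLimit η → η ∈ vanishingLevels T
  exclusive : ∀ α : Set.Iic η, ¬ IsMin α.1 → ∀ t ∈ treeLevel T α.1, {τ | t.Excl (f α τ)} ∈ GenBy X

/-- `p ≤ q` iff `p` end-extends `q` in both coordinates. -/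
instance SForcing.instPreorder (X : Z → Set Θ) : Preorder (SForcing K X) where
  le p q := q.η ≤ p.η ∧ (∀ t, t ∈ q.T ↔ t ∈ p.T ∧ t.dom ≤ q.η) ∧
    ∀ α (hq : α ≤ q.η) (hp : α ≤ p.η), p.f ⟨α, hp⟩ = q.f ⟨α, hq⟩
  le_refl p := ⟨le_rfl, fun t => ⟨fun h => ⟨h, p.height.2 t h⟩, fun h => h.1⟩, fun _ _ _ => rfl⟩
  le_trans p q r hpq hqr := by
    obtain ⟨h1, h2, h3⟩ := hpq
    obtain ⟨k1, k2, k3⟩ := hqr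
    refine ⟨k1.trans h1, fun t => ?_, fun α ha hp => ?_⟩
    · rw [k2, h2]
      exact ⟨fun h => ⟨h.1.1, h.2⟩, fun h => ⟨⟨h.1, h.2.trans k1⟩, h.2⟩⟩
    · rw [h3 α (ha.trans k1) hp, k3 α ha]

end Trees

section Generic

variable {K : Type u} [LinearOrder K] [WellFoundedLT K]
variable {Θ : Type u} [LinearOrder Θ] [WellFoundedLT Θ]
variable {Z : Type u} [LinearOrder Z] [WellFoundedLT Z]

/-- The canonical name of a node, a function from ordinals to ordinals. -/
def nodeName {P : Type u} (t : Node K) : PName P :=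
  PName.ofFamily fun ε : Set.Iio t.dom =>
    PName.opair (PName.ofOrd ε.1) (PName.ofOrd (t.val ε.1 ε.2))

/-- The canonical name of a function from `θ` to the nodes. -/
def nodeSeqName {P : Type u} (g : Θ → Node K) : PName P :=
  PName.ofFamily fun τ : Θ => PName.opair (PName.ofOrd τ) (nodeName (g τ))

/-- The name of the generic sequence `f^G = ⋃ {f | (T, f) ∈ G}`, where each `f` is the set of the
pairs `(α, f(α))`. -/
def genericPath (K : Type u) [LinearOrder K] [WellFoundedLT K] (X : Z → Set Θ) :
    PName (SForcing K X) :=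
  PName.mk (Σ p : SForcing K X, Set.Iic p.η)
    (fun i => PName.opair (PName.ofOrd i.2.1) (nodeSeqName (i.1.f i.2))) (fun i => i.1)

/-- "`τ ∈ supp(g, h)`", that is, `g(τ) ⊆ h(τ)` or `g(τ) ⊇ h(τ)`. -/
def memSupp {P : Type u} [Preorder P] (g h τ : PName P) : FSent P :=
  FSent.ex fun s => FSent.ex fun t =>
    FSent.and (PName.mem (PName.opair τ s) g) <|
    FSent.and (PName.mem (PName.opair τ t) h) <|
    FSent.or (PName.sub s t) (PName.sub t s)

/-- The poset `A^κ_{X,ξ}` of the extension: its underlying set is `κ`, and `β ≤ α` holds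
iff `α ≤ β` as ordinals and `X_ξ ⊆ supp(f^G(α), f^G(β))`. -/
def APoset (K : Type u) [LinearOrder K] [WellFoundedLT K] (X : Z → Set Θ) (ξ : Z) :
    PosetName (SForcing K X) where
  carrier := PName.ofType K
  le := fun β α =>
    FSent.and (FSent.or (PName.mem α β) (PName.eq α β)) <|
    FSent.ex fun g => FSent.ex fun h =>
      FSent.and (PName.mem (PName.opair α g) (genericPath K X)) <|
      FSent.and (PName.mem (PName.opair β h) (genericPath K X)) <|
      PName.ballIn (PName.ofOrdSet (X ξ)) fun τ => memSupp g h τ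

end Generic

/-! Let `A` name an antichain. If some condition bounds the indices of its possible elements below
`κ`, then these are among fewer than `κ` names from the ground model, and an injection into an
ordinal below `κ` can be written down there (`cardLT_of_decided`). Otherwise elements of arbitrarily
large index are forced into `A` densely often, and `exists_sub_of_unbounded` finds a condition
forcing two elements `α < β` into `A` with `f(α)(τ) ⊆ f(β)(τ)` on all of `X_ξ`. Then `β` is below
both, a contradiction (`forced_hasCC`).

To find `α` and `β`, descend along `θ⁺` many conditions whose last functions extend each other at
every coordinate, to a limit whose last level consists only of nodes `t * b_σ`, with `t` from an
earlier tree and `b` the last function. Extend the limit so that some `β` above its height is forced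
into `A`. Restricted to the limit, `f(β)(τ)` is `t(τ) * b_{σ(τ)}`, and as `θ⁺` is regular all `t(τ)`
occur before one stage `k < θ⁺`. Because `λ^θ < κ`, the step at `k` can treat every pair `(t, σ)`:
if some extension offers a suitable `α` with `f(α)` following `t * b ∘ σ`, the step prolongs `b` so
that `t * b ∘ σ` follows such an `f(α)`. The condition with `β` shows that the premise held at stage
`k`, so an earlier `α` was caught.

Catching (`exists_catches`) leads the coordinate `σ(τ)` of the last function along `f(α)(τ)`. Mutual
exclusivity makes `σ` injective on `X_ξ`, and since `θ \ X_ξ` has size `θ` the inverse extends to an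
injection of `θ`, which preserves mutual exclusivity. On filter-many coordinates nothing changes.

Limit levels must be vanishing. Constructions therefore carry one spare branch for every future
limit, kept apart from the path and from the other branches and dropped at its limit
(`exists_limit`, `exists_run`). Since a step of the long run is itself a transfinite run, the inner
run preserves the branches of the outer one. -/

open Cardinal

/-! ### Equality, pairs and ordinals in the forcing language -/

namespace PName
variable {P : Type u} [Preorder P]

theorem eq_iff {x y : PName P} {p : P} : eq x y p ↔
    (∀ i, ∀ q ≤ p, q ≤ x.cnd i → ∀ r ≤ q, ∃ s ≤ r, ∃ j, s ≤ y.cnd j ∧ eq (x.elt i) (y.elt j) s) ∧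
    (∀ j, ∀ q ≤ p, q ≤ y.cnd j → ∀ r ≤ q, ∃ s ≤ r, ∃ i, s ≤ x.cnd i ∧ eq (x.elt i) (y.elt j) s) := by
  cases x; cases y; rw [eq]; rfl

theorem mem_iff {x y : PName P} {p : P} : mem x y p ↔
    ∀ q ≤ p, ∃ r ≤ q, ∃ j, r ≤ y.cnd j ∧ eq x (y.elt j) r := by
  cases y; rfl

theorem eq_mono {x y : PName P} {p q : P} (h : eq x y p) (hq : q ≤ p) : eq x y q := by
  rw [eq_iff] at h ⊢
  exact ⟨fun i r hr => h.1 i r (hr.trans hq), fun i r hr => h.2 i r (hr.trans hq)⟩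

theorem mem_mono {x y : PName P} {p q : P} (h : mem x y p) (hq : q ≤ p) : mem x y q := by
  rw [mem_iff] at h ⊢
  exact fun r hr => h r (hr.trans hq)

theorem eq_of_dense {x y : PName P} {p : P} (h : ∀ q ≤ p, ∃ r ≤ q, eq x y r) : eq x y p := by
  rw [eq_iff]
  refine ⟨fun i q hq hqi r hr => ?_, fun i q hq hqi r hr => ?_⟩
  · obtain ⟨s, hs, e⟩ := h r (hr.trans hq)
    obtain ⟨s', hs', k⟩ := (eq_iff.1 e).1 i s le_rfl (hs.trans (hr.trans hqi)) s le_rfl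
    exact ⟨s', hs'.trans hs, k⟩
  · obtain ⟨s, hs, e⟩ := h r (hr.trans hq)
    obtain ⟨s', hs', k⟩ := (eq_iff.1 e).2 i s le_rfl (hs.trans (hr.trans hqi)) s le_rfl
    exact ⟨s', hs'.trans hs, k⟩

theorem eq_refl (x : PName P) (p : P) : eq x x p := by
  induction x generalizing p with
  | mk ι a c ih =>
    rw [eq_iff]
    exact ⟨fun i q _ hqi r hr => ⟨r, le_rfl, i, hr.trans hqi, ih i r⟩,
      fun i q _ hqi r hr => ⟨r, le_rfl, i, hr.trans hqi, ih i r⟩⟩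

theorem eq_symm {x y : PName P} {p : P} (h : eq x y p) : eq y x p := by
  induction x generalizing y p with
  | mk ι a c ih =>
    rw [eq_iff] at h ⊢
    refine ⟨fun i q hq hqi r hr => ?_, fun i q hq hqi r hr => ?_⟩
    · obtain ⟨s, hs, j, hj, e⟩ := h.2 i q hq hqi r hr
      exact ⟨s, hs, j, hj, ih _ e⟩
    · obtain ⟨s, hs, j, hj, e⟩ := h.1 i q hq hqi r hr
      exact ⟨s, hs, j, hj, ih _ e⟩

theorem eq_trans {x y z : PName P} {p : P} (h : eq x y p) (h' : eq y z p) : eq x z p := by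
  induction x generalizing y z p with
  | mk ι a c ih =>
    rw [eq_iff] at h h' ⊢
    refine ⟨fun i q hq hqi r hr => ?_, fun i q hq hqi r hr => ?_⟩
    · obtain ⟨s, hs, j, hj, e⟩ := h.1 i q hq hqi r hr
      obtain ⟨s', hs', k, hk, e'⟩ := h'.1 j s (hs.trans (hr.trans hq)) hj s le_rfl
      exact ⟨s', hs'.trans hs, k, hk, ih _ (eq_mono e hs') e'⟩
    · obtain ⟨s, hs, j, hj, e⟩ := h'.2 i q hq hqi r hr
      obtain ⟨s', hs', k, hk, e'⟩ := h.2 j s (hs.trans (hr.trans hq)) hj s le_rfl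
      exact ⟨s', hs'.trans hs, k, hk, ih _ e' (eq_mono e hs')⟩

theorem mem_congr_left {x x' y : PName P} {p : P} (h : mem x y p) (e : eq x x' p) :
    mem x' y p := by
  rw [mem_iff] at h ⊢
  intro q hq
  obtain ⟨r, hr, j, hj, k⟩ := h q hq
  exact ⟨r, hr, j, hj, eq_trans (eq_symm (eq_mono e (hr.trans hq))) k⟩

theorem mem_congr_right {x y y' : PName P} {p : P} (h : mem x y p) (e : eq y y' p) :
    mem x y' p := by
  rw [mem_iff] at h ⊢
  intro q hq
  obtain ⟨r, hr, j, hj, k⟩ := h q hq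
  obtain ⟨s, hs, i, hi, l⟩ := (eq_iff.1 e).1 j r (hr.trans hq) hj r le_rfl
  exact ⟨s, hs.trans hr, i, hi, eq_trans (eq_mono k hs) l⟩

theorem mem_elt (y : PName P) (i : y.idx) {p : P} (hp : p ≤ y.cnd i) : mem (y.elt i) y p :=
  mem_iff.2 fun q hq => ⟨q, le_rfl, i, hq.trans hp, eq_refl _ _⟩

theorem mem_ofFamily {I : Type u} {f : I → PName P} {x : PName P} {p : P} :
    mem x (ofFamily f) p ↔ ∀ q ≤ p, ∃ r ≤ q, ∃ i, eq x (f i) r := by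
  rw [mem_iff]
  refine forall₂_congr fun q hq => ⟨?_, ?_⟩
  · rintro ⟨r, hr, j, _, e⟩
    exact ⟨r, hr, j.1, e⟩
  · rintro ⟨r, hr, j, e⟩
    exact ⟨r, hr, (j, r), le_rfl, e⟩

theorem mem_ofFamily_self {I : Type u} (f : I → PName P) (i : I) (p : P) :
    mem (f i) (ofFamily f) p :=
  mem_ofFamily.2 fun q _ => ⟨q, le_rfl, i, eq_refl _ _⟩

theorem mem_upair {x y z : PName P} {p : P} :
    mem z (upair x y) p ↔ ∀ q ≤ p, ∃ r ≤ q, eq z x r ∨ eq z y r := by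
  rw [upair, mem_ofFamily]
  refine forall₂_congr fun q _ => exists_congr fun r => and_congr_right fun _ => ⟨?_, ?_⟩
  · rintro ⟨⟨b⟩, e⟩
    cases b
    · exact Or.inr e
    · exact Or.inl e
  · rintro (e | e)
    · exact ⟨⟨true⟩, e⟩
    · exact ⟨⟨false⟩, e⟩

theorem left_mem_upair (x y : PName P) (p : P) : mem x (upair x y) p :=
  mem_upair.2 fun q _ => ⟨q, le_rfl, Or.inl (eq_refl _ _)⟩

theorem right_mem_upair (x y : PName P) (p : P) : mem y (upair x y) p :=
  mem_upair.2 fun q _ => ⟨q, le_rfl, Or.inr (eq_refl _ _)⟩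

theorem eq_of_forall_mem {x y : PName P} {p : P}
    (h : ∀ z, ∀ q ≤ p, mem z x q → mem z y q) (h' : ∀ z, ∀ q ≤ p, mem z y q → mem z x q) :
    eq x y p := by
  rw [eq_iff]
  refine ⟨fun i q hq hqi r hr => ?_, fun i q hq hqi r hr => ?_⟩
  · exact mem_iff.1 (h _ q hq (mem_elt x i hqi)) r hr
  · obtain ⟨s, hs, j, hj, e⟩ := mem_iff.1 (h' _ q hq (mem_elt y i hqi)) r hr
    exact ⟨s, hs, j, hj, eq_symm e⟩

theorem upair_congr {x y z w : PName P} {p : P} (h : eq x z p) (h' : eq y w p) :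
    eq (upair x y) (upair z w) p := by
  refine eq_of_forall_mem (fun v q hq hv => ?_) (fun v q hq hv => ?_) <;>
    rw [mem_upair] at hv ⊢ <;> intro r hr <;> obtain ⟨s, hs, k⟩ := hv r hr <;>
    refine ⟨s, hs, k.imp (fun e => ?_) (fun e => ?_)⟩
  · exact eq_trans e (eq_mono h (hs.trans (hr.trans hq)))
  · exact eq_trans e (eq_mono h' (hs.trans (hr.trans hq)))
  · exact eq_trans e (eq_symm (eq_mono h (hs.trans (hr.trans hq))))
  · exact eq_trans e (eq_symm (eq_mono h' (hs.trans (hr.trans hq))))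

theorem opair_congr {x y z w : PName P} {p : P} (h : eq x z p) (h' : eq y w p) :
    eq (opair x y) (opair z w) p :=
  upair_congr (upair_congr h h) (upair_congr h h')

/-- Which matching holds need not be decided by `p`; four successive strengthenings settle where
each of the four entries goes. -/
theorem exists_of_upair_eq {x y z w : PName P} {p : P} (h : eq (upair x y) (upair z w) p) :
    ∃ q ≤ p, (eq x z q ∧ eq y w q) ∨ (eq x w q ∧ eq y z q) := by
  obtain ⟨q, hq, hx⟩ := mem_upair.1 (mem_congr_right (left_mem_upair x y p) h) p le_rfl
  obtain ⟨r, hr, hy⟩ := mem_upair.1 (mem_congr_right (right_mem_upair x y p) h) q hq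
  have hx : eq x z r ∨ eq x w r := hx.imp (eq_mono · hr) (eq_mono · hr)
  obtain ⟨s, hs, hz⟩ := mem_upair.1 (mem_congr_right (left_mem_upair z w p) (eq_symm h)) r
    (hr.trans hq)
  obtain ⟨t, ht, hw⟩ := mem_upair.1 (mem_congr_right (right_mem_upair z w p) (eq_symm h)) s
    (hs.trans (hr.trans hq))
  have hx : eq x z t ∨ eq x w t := hx.imp (eq_mono · (ht.trans hs)) (eq_mono · (ht.trans hs))
  have hy : eq y z t ∨ eq y w t := hy.imp (eq_mono · (ht.trans hs)) (eq_mono · (ht.trans hs))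
  have hz : eq z x t ∨ eq z y t := hz.imp (eq_mono · ht) (eq_mono · ht)
  refine ⟨t, ht.trans (hs.trans (hr.trans hq)), ?_⟩
  rcases hx with hx | hx <;> rcases hy with hy | hy
  · refine Or.inl ⟨hx, ?_⟩
    rcases hw with hw | hw
    · exact eq_trans hy (eq_trans (eq_symm hx) (eq_symm hw))
    · exact eq_symm hw
  · exact Or.inl ⟨hx, hy⟩
  · exact Or.inr ⟨hx, hy⟩
  · refine Or.inr ⟨hx, ?_⟩
    rcases hz with hz | hz
    · exact eq_trans hy (eq_trans (eq_symm hx) (eq_symm hz))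
    · exact eq_symm hz

/-- The case distinction is available only on a dense set, but all cases give the same equalities,
so `eq_of_dense` brings them back to `p`. -/
theorem opair_inj {x y z w : PName P} {p : P} (h : eq (opair x y) (opair z w) p) :
    eq x z p ∧ eq y w p := by
  have key : ∀ q ≤ p, ∃ r ≤ q, eq x z r ∧ eq y w r := by
    intro q hq
    obtain ⟨r, hr, ⟨h1, h2⟩ | ⟨h1, h2⟩⟩ := exists_of_upair_eq (eq_mono h hq)
    · obtain ⟨s, hs, h3⟩ := exists_of_upair_eq h1
      have h3 : eq x z s := h3.elim And.left And.left
      obtain ⟨t, ht, h4 | h4⟩ := exists_of_upair_eq (eq_mono h2 hs)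
      · exact ⟨t, ht.trans (hs.trans hr), h4⟩
      · have h3 := eq_mono h3 ht
        exact ⟨t, ht.trans (hs.trans hr), h3, eq_trans h4.2 (eq_trans (eq_symm h3) h4.1)⟩
    · obtain ⟨s, hs, h3⟩ := exists_of_upair_eq h1
      have h3 : eq x z s ∧ eq x w s := h3.elim id And.symm
      obtain ⟨t, ht, h4⟩ := exists_of_upair_eq (eq_mono h2 hs)
      have h4 : eq y z t := h4.elim And.right And.right
      exact ⟨t, ht.trans (hs.trans hr), eq_mono h3.1 ht,
        eq_trans h4 (eq_trans (eq_symm (eq_mono h3.1 ht)) (eq_mono h3.2 ht))⟩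
  exact ⟨eq_of_dense fun q hq => (key q hq).imp fun r hr => ⟨hr.1, hr.2.1⟩,
    eq_of_dense fun q hq => (key q hq).imp fun r hr => ⟨hr.1, hr.2.2⟩⟩

theorem not_mem_empty (x : PName P) (p : P) : ¬ mem x empty p := by
  intro h
  obtain ⟨_, _, i, _⟩ := mem_ofFamily.1 h p le_rfl
  exact i.elim

theorem opair_ne_empty (x y : PName P) (p : P) : ¬ eq (opair x y) empty p := fun h =>
  not_mem_empty _ _ (mem_congr_right (left_mem_upair _ _ p) h)

section Ord
variable {I : Type u} [LinearOrder I] [WellFoundedLT I]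

theorem ofOrd_def (i : I) : (ofOrd i : PName P) = ofFamily fun j : Set.Iio i => ofOrd j.1 := by
  rw [ofOrd]

theorem ofOrd_mem {i j : I} (h : i < j) (p : P) : mem (ofOrd i) (ofOrd j) p := by
  rw [ofOrd_def j]
  exact mem_ofFamily_self (fun k : Set.Iio j => ofOrd k.1) ⟨i, h⟩ p

/-- If the positions differed, the smaller one would be forced to be a member of itself, hence equal
to a still smaller one, which the induction excludes. -/
theorem ofOrd_inj {i j : I} {p : P} (h : eq (ofOrd i) (ofOrd j) p) : i = j := by
  induction i using WellFoundedLT.induction generalizing j p with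
  | ind i ih =>
    rcases lt_trichotomy i j with hij | hij | hij
    · have h1 := mem_congr_right (ofOrd_mem hij p) (eq_symm h)
      rw [ofOrd_def i, mem_ofFamily] at h1
      obtain ⟨q, _, ⟨k, hk⟩, e⟩ := h1 p le_rfl
      rw [← ofOrd_def] at e
      exact absurd (ih k hk (eq_symm e)) (ne_of_lt hk)
    · exact hij
    · have h1 := mem_congr_right (ofOrd_mem hij p) h
      rw [ofOrd_def j, mem_ofFamily] at h1
      obtain ⟨q, _, ⟨k, hk⟩, e⟩ := h1 p le_rfl
      rw [← ofOrd_def] at e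
      exact absurd (ih j hij e) (ne_of_gt hk)

theorem mem_ofOrdSet {S : Set I} {x : PName P} {p : P} :
    mem x (ofOrdSet S) p ↔ ∀ q ≤ p, ∃ r ≤ q, ∃ i ∈ S, eq x (ofOrd i) r := by
  rw [ofOrdSet, mem_ofFamily]
  simp only [Subtype.exists, exists_prop]

theorem ofOrd_mem_ofType (i : I) (p : P) : mem (ofOrd i) (ofType I) p :=
  mem_ofOrdSet.2 fun q _ => ⟨q, le_rfl, i, trivial, eq_refl _ _⟩

/-- If every element of `A` is forced to be one of the distinct sets named by `n i`, `i ∈ I`, then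
`A` is forced to be smaller than any `κ` for which `I` injects into a proper initial segment
of `κ`. -/
theorem cardLT_of_decided {K : Type u} [LinearOrder K] [WellFoundedLT K] {J : Type u}
    {A : PName P} {p : P} (n : J → PName P) (hn : ∀ i j q, eq (n i) (n j) q → i = j)
    (e : J → K) (he : Function.Injective e) (b : K) (heb : ∀ i, e i < b)
    (hA : ∀ q ≤ p, ∀ a, mem a A q → ∃ r ≤ q, ∃ i, eq a (n i) r) :
    cardLT A (ofType K) p := by
  -- `F` lists all `n i`, whether or not they enter `A`. Only its totality on `A` uses the decisions
  -- `hA`.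
  set F : PName P := ofFamily fun i => opair (n i) (ofOrd (e i)) with hF
  have hFmem : ∀ a c q, mem (opair a c) F q →
      ∀ r ≤ q, ∃ s ≤ r, ∃ i, eq a (n i) s ∧ eq c (ofOrd (e i)) s := by
    intro a c q h r hr
    obtain ⟨s, hs, i, k⟩ := mem_ofFamily.1 h r hr
    exact ⟨s, hs, i, opair_inj k⟩
  intro q hq
  refine ⟨q, le_rfl, ofOrd b, ofOrd_mem_ofType b q, fun r hr => ⟨r, le_rfl, F, ?_, ?_, ?_⟩⟩
  · intro a s hs ha t ht
    obtain ⟨v, hv, i, k⟩ := hA t (ht.trans (hs.trans (hr.trans hq))) a (mem_mono ha ht)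
    refine ⟨v, hv, ofOrd (e i), ofOrd_mem (heb i) v, ?_⟩
    exact mem_congr_left (mem_ofFamily_self (fun i => opair (n i) (ofOrd (e i))) i v)
      (opair_congr (eq_symm k) (eq_refl _ _))
  · intro a s _ _ c c' t ht hc v hv hc'
    refine eq_of_dense fun w hw => ?_
    obtain ⟨w1, hw1, i, k1, k2⟩ := hFmem _ _ _ hc w (hw.trans hv)
    obtain ⟨w2, hw2, j, l1, l2⟩ := hFmem _ _ _ hc' w1 (hw1.trans hw)
    obtain rfl := hn i j w2 (eq_trans (eq_symm (eq_mono k1 hw2)) l1)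
    exact ⟨w2, hw2.trans hw1, eq_trans (eq_mono k2 hw2) (eq_symm l2)⟩
  · intro a s _ _ a' s' _ _ c t ht hc v hv hc'
    refine eq_of_dense fun w hw => ?_
    obtain ⟨w1, hw1, i, k1, k2⟩ := hFmem _ _ _ hc w (hw.trans hv)
    obtain ⟨w2, hw2, j, l1, l2⟩ := hFmem _ _ _ hc' w1 (hw1.trans hw)
    obtain rfl := he (ofOrd_inj (eq_trans (eq_symm (eq_mono k2 hw2)) l2))
    exact ⟨w2, hw2.trans hw1, eq_trans (eq_mono k1 hw2) (eq_symm l1)⟩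

end Ord
end PName

/-! ### Nodes, vanishing levels, the filter, and basic facts about conditions -/

section Trees
variable {K : Type u} [LinearOrder K]

namespace Node
variable {s t u v s' t' : Node K}

theorem Sub.refl (s : Node K) : s.Sub s := ⟨le_rfl, fun _ _ _ => rfl⟩

theorem Sub.trans (h : s.Sub t) (h' : t.Sub u) : s.Sub u :=
  ⟨h.1.trans h'.1, fun ε hs hu =>
    (h.2 ε hs (hs.trans_le h.1)).trans (h'.2 ε (hs.trans_le h.1) hu)⟩

theorem eq_of_val (h : s.dom = t.dom) (h' : ∀ ε hs ht, s.val ε hs = t.val ε ht) : s = t := by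
  obtain ⟨d, f⟩ := s
  obtain ⟨e, g⟩ := t
  obtain rfl : d = e := h
  congr 1
  funext ε hε
  exact h' ε hε hε

theorem Sub.eq_of_dom_le (h : s.Sub t) (hd : t.dom ≤ s.dom) : s = t :=
  eq_of_val (le_antisymm h.1 hd) h.2

theorem Sub.of_common (h : s.Sub u) (h' : t.Sub u) (hd : s.dom ≤ t.dom) : s.Sub t :=
  ⟨hd, fun ε hs ht => (h.2 ε hs (hs.trans_le h.1)).trans (h'.2 ε ht (ht.trans_le h'.1)).symm⟩

/-- The restriction of a node to an ordinal below its domain. -/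
def restrict (t : Node K) (α : K) (h : α ≤ t.dom) : Node K where
  dom := α
  val := fun ε hε => t.val ε (hε.trans_le h)

theorem restrict_sub (t : Node K) (α : K) (h : α ≤ t.dom) : (t.restrict α h).Sub t :=
  ⟨h, fun _ _ _ => rfl⟩

theorem star_val_of_lt {ε : K} (h : ε < s.dom) (h' : ε < (s.star t).dom) :
    (s.star t).val ε h' = s.val ε h := dif_pos h

theorem star_val_of_le {ε : K} (h : s.dom ≤ ε) (h' : ε < (s.star t).dom) :
    (s.star t).val ε h' = t.val ε h' := dif_neg h.not_gt

theorem star_sub_left (h : t.dom ≤ s.dom) : (s.star t).Sub s :=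
  ⟨h, fun _ hε hs => star_val_of_lt hs hε⟩

theorem sub_star (h : s.dom ≤ t.dom) : s.Sub (s.star t) :=
  ⟨h, fun _ hs hε => (star_val_of_lt hs hε).symm⟩

theorem Sub.star_right (h : t.Sub t') (s : Node K) : (s.star t).Sub (s.star t') := by
  refine ⟨h.1, fun ε h1 h2 => ?_⟩
  rcases lt_or_ge ε s.dom with hε | hε
  · rw [star_val_of_lt hε, star_val_of_lt hε]
  · rw [star_val_of_le hε, star_val_of_le hε]
    exact h.2 _ _ _

theorem Sub.star_eq (h : s.Sub t) : s.star t = t := by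
  refine eq_of_val rfl fun ε h1 h2 => ?_
  rcases lt_or_ge ε s.dom with hε | hε
  · rw [star_val_of_lt hε]
    exact h.2 _ _ _
  · rw [star_val_of_le hε]

/-- Together with `star_star_of_le` this rewrites `s * (w * d)` as `w' * d` with `w'` in the tree,
which gives homogeneity at limits. -/
theorem star_assoc_of_le (h : s.dom ≤ u.dom) (t : Node K) :
    s.star (u.star t) = (s.star u).star t := by
  refine eq_of_val rfl fun ε h1 h2 => ?_
  simp only [star]
  grind

theorem star_star_of_le (h : u.dom ≤ s.dom) (t : Node K) : s.star (u.star t) = s.star t := by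
  refine eq_of_val rfl fun ε h1 h2 => ?_
  simp only [star]
  grind

theorem Excl.star (h : s.Excl s') (h' : t.Excl t') (hd : s.dom = s'.dom) :
    (s.star t).Excl (s'.star t') := by
  intro ε h1 h2
  rcases lt_or_ge ε s.dom with hs | hs
  · rw [star_val_of_lt hs, star_val_of_lt (hd ▸ hs)]
    exact h _ _ _
  · rw [star_val_of_le hs, star_val_of_le (hd ▸ hs)]
    exact h' _ _ _

/-- The union of a chain of nodes. -/
theorem exists_union {J : Type*} [LinearOrder J] (n : J → Node K)
    (hn : ∀ i j, i ≤ j → (n i).Sub (n j)) (η : K) (hη : ∀ ε < η, ∃ j, ε < (n j).dom)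
    (hle : ∀ j, (n j).dom ≤ η) : ∃ b : Node K, b.dom = η ∧ ∀ j, (n j).Sub b := by
  choose j hj using hη
  refine ⟨⟨η, fun ε hε => (n (j ε hε)).val ε (hj ε hε)⟩, rfl,
    fun i => ⟨hle i, fun ε h1 h2 => ?_⟩⟩
  rcases le_total i (j ε h2) with h | h
  · exact (hn _ _ h).2 _ _ _
  · exact ((hn _ _ h).2 _ _ _).symm

/-- Two nodes do not share a value at `ε`. -/
def DiffAt (s t : Node K) (ε : K) : Prop :=
  ∀ (hs : ε < s.dom) (ht : ε < t.dom), s.val ε hs ≠ t.val ε ht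

theorem DiffAt.of_sub {ε : K} (h : s.DiffAt t ε) (hs : s.Sub s') (ht : t.Sub t')
    (h1 : ε < s.dom) (h2 : ε < t.dom) : s'.DiffAt t' ε := fun k1 k2 => by
  rw [← hs.2 ε h1 k1, ← ht.2 ε h2 k2]
  exact h h1 h2

theorem DiffAt.star {ε : K} (h : s.DiffAt t ε) (hu : u.dom ≤ ε) (hv : v.dom ≤ ε) :
    (u.star s).DiffAt (v.star t) ε := fun h1 h2 => by
  rw [star_val_of_le hu, star_val_of_le hv]
  exact h h1 h2

variable [SuccOrder K]

/-- The extension of a node by one further value. -/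
def snoc (t : Node K) (a : K) : Node K where
  dom := Order.succ t.dom
  val := fun ε _ => if h : ε < t.dom then t.val ε h else a

theorem sub_snoc (t : Node K) (a : K) : t.Sub (t.snoc a) :=
  ⟨Order.le_succ _, fun _ h _ => (dif_pos h).symm⟩

theorem star_snoc (h : s.dom ≤ t.dom) (a : K) : s.star (t.snoc a) = (s.star t).snoc a := by
  refine eq_of_val rfl fun ε h1 h2 => ?_
  simp only [star, snoc]
  grind

theorem Excl.snoc (h : s.Excl t) (hd : s.dom = t.dom) {a b : K} (hab : a ≠ b) :
    (s.snoc a).Excl (t.snoc b) := by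
  intro ε h1 h2
  simp only [Node.snoc]
  by_cases hs : ε < s.dom
  · rw [dif_pos hs, dif_pos (hd ▸ hs)]
    exact h _ _ _
  · rwa [dif_neg hs, dif_neg (hd ▸ hs)]

end Node

theorem IsTree.restrict_mem {T : Set (Node K)} (hT : IsTree T) {t : Node K} (ht : t ∈ T) {α : K}
    (h : α ≤ t.dom) : t.restrict α h ∈ T := hT t ht _ (t.restrict_sub α h)

/-- Vanishing at `γ` depends only on the nodes of domain at most `γ`. -/
theorem mem_vanishingLevels_of_agree {T T' : Set (Node K)} {α γ : K}
    (h : ∀ t : Node K, t.dom ≤ α → (t ∈ T ↔ t ∈ T')) (hγ : γ ≤ α)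
    (hT : γ ∈ vanishingLevels T) : γ ∈ vanishingLevels T' := by
  refine ⟨hT.1, fun x hx hxd => ?_⟩
  obtain ⟨b, ⟨hb, hbT, hbn⟩, hxb⟩ := hT.2 x ((h x (hxd.le.trans hγ)).2 hx) hxd
  refine ⟨b, ⟨hb, fun s hs hsd => ?_, fun hn => hbn ?_⟩, hxb⟩
  · exact (h s (hsd.le.trans hγ)).1 (hbT s hs hsd)
  · exact (h b (hb.le.trans hγ)).2 hn

/-- A branch vanishing at a limit `γ > η` would have initial segments in `T` that are longer than
`η`. -/
theorem le_of_mem_vanishingLevels {T : Set (Node K)} {η γ : K} (hT : HasTopLevel T η)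
    (hγ : γ ∈ vanishingLevels T) : γ ≤ η := by
  by_contra! hlt
  obtain ⟨⟨t, ht, htd⟩, hle⟩ := hT
  obtain ⟨b, ⟨hb, hbT, hbn⟩, -⟩ := hγ.2 t ht (htd.trans_lt hlt)
  obtain ⟨δ, hηδ, hδγ⟩ : ∃ δ, η < δ ∧ δ < γ := by
    by_contra! hno
    exact hγ.1.2 η ⟨hlt, fun δ h1 h2 => (hno δ h1).not_gt h2⟩
  have := hle _ (hbT (b.restrict δ (hb ▸ hδγ.le)) (b.restrict_sub _ _) hδγ)
  exact this.not_gt hηδ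

/-- Limit points cannot exceed `η`; those below `η` are inherited from trees agreeing with `T` that
far, and `η` itself is covered by `hη`. -/
theorem isClosedOrd_vanishingLevels {T : Set (Node K)} {η : K} (hT : HasTopLevel T η)
    (hlow : ∀ α < η, ∃ T' : Set (Node K), IsClosedOrd (vanishingLevels T') ∧
      ∀ t : Node K, t.dom ≤ α → (t ∈ T ↔ t ∈ T'))
    (hη : Order.IsSuccLimit η → η ∈ vanishingLevels T) : IsClosedOrd (vanishingLevels T) := by
  intro α hα hacc
  have hle : α ≤ η := by
    by_contra! hlt
    obtain ⟨γ, hγ, h1, h2⟩ := hacc η hlt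
    exact (le_of_mem_vanishingLevels hT hγ).not_gt h1
  rcases hle.lt_or_eq with hlt | rfl
  · obtain ⟨T', hT', hag⟩ := hlow α hlt
    refine mem_vanishingLevels_of_agree (fun t ht => (hag t ht).symm) le_rfl
      (hT' α hα fun β hβ => ?_)
    obtain ⟨γ, hγ, h1, h2⟩ := hacc β hβ
    exact ⟨γ, mem_vanishingLevels_of_agree hag h2.le hγ, h1, h2⟩
  · exact hη hα

variable {Θ Z : Type u}

section Filter
variable {X : Z → Set Θ}

theorem GenBy.superset {A B : Set Θ} (hA : A ∈ GenBy X) (h : A ⊆ B) : B ∈ GenBy X :=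
  hA.imp fun _ hξ => hξ.trans h

theorem GenBy.univ_mem [Nonempty Z] : Set.univ ∈ GenBy X := ⟨Classical.arbitrary Z, Set.subset_univ _⟩

theorem GenBy.inter [LinearOrder Z] (hX : Antitone X) {A B : Set Θ} (hA : A ∈ GenBy X)
    (hB : B ∈ GenBy X) : A ∩ B ∈ GenBy X := by
  obtain ⟨ξ, hξ⟩ := hA
  obtain ⟨ξ', hξ'⟩ := hB
  exact ⟨max ξ ξ', Set.subset_inter ((hX (le_max_left _ _)).trans hξ)
    ((hX (le_max_right _ _)).trans hξ')⟩

/-- Some `X ξ` misses `τ`. Hence one coordinate may always be sacrificed when exclusivity is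
checked. -/
theorem GenBy.ne_mem (hcap : ⋂ ξ, X ξ = ∅) (τ : Θ) : {σ | σ ≠ τ} ∈ GenBy X := by
  have : τ ∉ ⋂ ξ, X ξ := hcap ▸ Set.notMem_empty τ
  simp only [Set.mem_iInter, not_forall] at this
  obtain ⟨ξ, hξ⟩ := this
  exact ⟨ξ, fun σ hσ e => hξ (e ▸ hσ)⟩

end Filter

namespace SForcing
variable {X : Z → Set Θ}

/-- The last function of the path of a condition. -/
def top (p : SForcing K X) : Θ → Node K := p.f ⟨p.η, le_rfl⟩

theorem f_mem (p : SForcing K X) (α : Set.Iic p.η) (τ : Θ) : p.f α τ ∈ p.T :=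
  (p.path.level α τ).1

theorem f_dom (p : SForcing K X) (α : Set.Iic p.η) (τ : Θ) : (p.f α τ).dom = α :=
  (p.path.level α τ).2

theorem top_mem (p : SForcing K X) (τ : Θ) : p.top τ ∈ p.T := p.f_mem _ τ

theorem top_dom (p : SForcing K X) (τ : Θ) : (p.top τ).dom = p.η := p.f_dom _ τ

/-- The levels decide the direction of comparability: an inclusion of the higher node in the lower
one is an equality. -/
theorem f_sub_mem [Nonempty Z] (p : SForcing K X) (α β : Set.Iic p.η) (h : α ≤ β) :
    {τ | (p.f α τ).Sub (p.f β τ)} ∈ GenBy X := by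
  rcases h.lt_or_eq with h | rfl
  · refine GenBy.superset (p.path.ascent α β h) fun τ hτ => hτ.elim id fun k => ?_
    have e := k.eq_of_dom_le (by rw [f_dom, f_dom]; exact h.le)
    change (p.f α τ).Sub (p.f β τ)
    rw [e]
    exact Node.Sub.refl _
  · exact GenBy.superset GenBy.univ_mem fun τ _ => Node.Sub.refl _

theorem f_eq_of_le {p q : SForcing K X} (h : p ≤ q) {α : K} (hα : α ≤ q.η) :
    p.f ⟨α, hα.trans h.1⟩ = q.f ⟨α, hα⟩ := h.2.2 α hα _

theorem mem_of_le {p q : SForcing K X} (h : p ≤ q) {t : Node K} (ht : t ∈ q.T) : t ∈ p.T :=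
  ((h.2.1 t).1 ht).1

theorem mem_iff_of_le {p q : SForcing K X} (h : p ≤ q) {t : Node K} (ht : t.dom ≤ q.η) :
    t ∈ p.T ↔ t ∈ q.T := by
  rw [h.2.1 t]
  exact ⟨fun k => ⟨k, ht⟩, fun k => k.1⟩

open Cardinal in
theorem mk_tree_lt (hκ : (#K).IsRegular) (hI : ∀ a : K, #(Set.Iic a) < #K) (p : SForcing K X) :
    #p.T < #K := by
  have : p.T = ⋃ α : Set.Iic p.η, treeLevel p.T α.1 := by
    ext t
    simp only [Set.mem_iUnion, treeLevel, Set.mem_ofPred_eq]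
    exact ⟨fun h => ⟨⟨t.dom, p.height.2 t h⟩, h, rfl⟩, fun ⟨_, h, _⟩ => h⟩
  rw [this, card_iUnion_lt_iff_forall_of_isRegular hκ (hI _)]
  exact fun α => p.narrow α

end SForcing
end Trees

/-! ### Adding one level to a condition -/

section Trees
variable {K : Type u} [LinearOrder K] {Θ Z : Type u} {X : Z → Set Θ}

namespace SForcing

variable [SuccOrder K] [NoMaxOrder K]

/-- Every condition has an extension by one level, in which the last function of the path and a
further node at the last level may be prescribed up to their last values. -/
theorem exists_succ [LinearOrder Z] [Nonempty Z] [Nonempty Θ] (hX : Antitone X) (hcap : ⋂ ξ, X ξ = ∅)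
    (hκ : (#K).IsRegular) (hΘ : #Θ < #K) (q : SForcing K X) {A : Type u} (hA : #A < #K)
    (g : Θ → Node K)
    (hg : ∀ τ, g τ ∈ treeLevel q.T q.η) (hgF : {τ | g τ = q.top τ} ∈ GenBy X)
    (hgx : ∀ τ τ', τ ≠ τ' → (g τ).Excl (g τ')) (c : A → Node K)
    (hc : ∀ a, c a ∈ treeLevel q.T q.η) :
    ∃ q' : SForcing K X, q' ≤ q ∧ q'.η = Order.succ q.η ∧ ∃ r : Θ ⊕ A → K, Function.Injective r ∧
      (∀ τ, q'.top τ = (g τ).snoc (r (.inl τ))) ∧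
      ∀ a, (c a).snoc (r (.inr a)) ∈ treeLevel q'.T q'.η := by
  have hΘA : #(Θ ⊕ A) < #K := by
    rw [mk_sum, lift_id, lift_id]
    exact add_lt_of_lt hκ.aleph0_le hΘ hA
  obtain ⟨⟨r, hr⟩⟩ := hΘA.le
  obtain ⟨τ₀⟩ := ‹Nonempty Θ›
  -- Every node of the last level gets the same new values, one for each path coordinate and each
  -- element of `A`. The uniformity gives homogeneity, the injectivity of `r` gives exclusivity.
  set T : Set (Node K) := q.T ∪ {s | ∃ t ∈ treeLevel q.T q.η, ∃ o, s = t.snoc (r o)} with hTdef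
  have hlt : q.η < Order.succ q.η := Order.lt_succ _
  have hlow : ∀ t : Node K, t.dom ≤ q.η → (t ∈ T ↔ t ∈ q.T) := by
    intro t ht
    refine ⟨?_, Or.inl⟩
    rintro (h | ⟨t0, ⟨_, h0⟩, o, rfl⟩)
    · exact h
    · change Order.succ t0.dom ≤ q.η at ht
      rw [h0] at ht
      exact absurd ht hlt.not_ge
  have hsn : ∀ t ∈ treeLevel q.T q.η, ∀ o, t.snoc (r o) ∈ treeLevel T (Order.succ q.η) :=
    fun t ht o => ⟨Or.inr ⟨t, ht, o, rfl⟩, congrArg Order.succ ht.2⟩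
  have htree : IsTree T := by
    rintro t (ht | ⟨t, ht, o, rfl⟩) s hs
    · exact Or.inl (q.tree t ht s hs)
    · rcases le_or_gt s.dom q.η with h | h
      · exact Or.inl (q.tree t ht.1 s (hs.of_common (t.sub_snoc _) (ht.2.symm ▸ h)))
      · rw [hs.eq_of_dom_le (by
          change Order.succ t.dom ≤ _
          rw [ht.2]
          exact Order.succ_le_of_lt h)]
        exact Or.inr ⟨t, ht, o, rfl⟩
  have htop : HasTopLevel T (Order.succ q.η) := by
    obtain ⟨⟨t, ht⟩, hle⟩ := q.height
    refine ⟨⟨_, hsn t ht (.inl τ₀)⟩, ?_⟩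
    rintro s (hs | ⟨t, ht, o, rfl⟩)
    · exact (hle s hs).trans hlt.le
    · exact (congrArg Order.succ ht.2).le
  set f : Set.Iic (Order.succ q.η) → Θ → Node K := fun α τ =>
    if h : α.1 ≤ q.η then q.f ⟨α.1, h⟩ τ else (g τ).snoc (r (.inl τ))
  have hf_low : ∀ (α : Set.Iic (Order.succ q.η)) (h : α.1 ≤ q.η), f α = q.f ⟨α.1, h⟩ :=
    fun α h => funext fun τ => dif_pos h
  have hf_top : ∀ (α : Set.Iic (Order.succ q.η)) (_ : ¬ α.1 ≤ q.η),
      f α = fun τ => (g τ).snoc (r (.inl τ)) := fun α h => funext fun τ => dif_neg h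
  have hsucc : ∀ α : Set.Iic (Order.succ q.η), ¬ α.1 ≤ q.η → α.1 = Order.succ q.η := fun α h =>
    le_antisymm α.2 (Order.succ_le_of_lt (not_le.1 h))
  have hnolim : ¬ Order.IsSuccLimit (Order.succ q.η) := Order.not_isSuccLimit_succ _
  let q' : SForcing K X :=
    { T := T
      η := Order.succ q.η
      f := f
      tree := htree
      height := htop
      normal := by
        intro x hx α hα
        rcases hα.lt_or_eq with hα | rfl
        · have hα : α ≤ q.η := Order.le_of_lt_succ hα
          rcases hx with hx | ⟨t, ht, o, rfl⟩
          · obtain ⟨y, hy, h⟩ := q.normal x hx α hα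
            exact ⟨y, ⟨Or.inl hy.1, hy.2⟩, h⟩
          · exact ⟨t.restrict α (ht.2.symm ▸ hα), ⟨Or.inl (q.tree.restrict_mem ht.1 _), rfl⟩,
              Or.inr ((t.restrict_sub _ _).trans (t.sub_snoc _))⟩
        · rcases hx with hx | ⟨t, ht, o, rfl⟩
          · obtain ⟨y, hy, h⟩ := q.normal x hx q.η le_rfl
            refine ⟨_, hsn y hy (.inl τ₀), Or.inl (Node.Sub.trans (t := y) ?_ (y.sub_snoc _))⟩
            refine h.elim id fun h => ?_
            rw [h.eq_of_dom_le (hy.2.symm ▸ q.height.2 x hx)]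
            exact Node.Sub.refl _
          · exact ⟨_, hsn t ht o, Or.inl (Node.Sub.refl _)⟩
      homogeneous := by
        intro s hs t ht
        rcases le_or_gt t.dom s.dom with h | h
        · exact htree s hs _ (Node.star_sub_left h)
        · have hs' : s.dom ≤ q.η := Order.le_of_lt_succ (h.trans_le (htop.2 t ht))
          have hs := (hlow s hs').1 hs
          rcases ht with ht | ⟨t, ht, o, rfl⟩
          · exact Or.inl (q.homogeneous s hs t ht)
          · rw [Node.star_snoc (ht.2.symm ▸ hs')]
            exact (hsn _ ⟨q.homogeneous s hs t ht.1, ht.2⟩ o).1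
      narrow := by
        intro α
        rcases le_or_gt α q.η with hα | hα
        · have : treeLevel T α = treeLevel q.T α := by
            ext t
            exact ⟨fun h => ⟨(hlow t (h.2.le.trans hα)).1 h.1, h.2⟩, fun h => ⟨Or.inl h.1, h.2⟩⟩
          rw [this]
          exact q.narrow α
        · have hsub : treeLevel T α ⊆
              Set.range fun x : treeLevel q.T q.η × (Θ ⊕ A) => x.1.1.snoc (r x.2) := by
            rintro t ⟨ht | ⟨t, ht, o, rfl⟩, htα⟩
            · exact absurd (q.height.2 t ht) (htα ▸ hα).not_ge
            · exact ⟨(⟨t, ht⟩, o), rfl⟩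
          refine (mk_le_mk_of_subset hsub).trans_lt (mk_range_le.trans_lt ?_)
          rw [mk_prod, lift_id, lift_id]
          exact mul_lt_of_lt hκ.aleph0_le (q.narrow _) hΘA
      path := by
        refine ⟨fun α τ => ?_, fun α β hαβ => ?_, fun α hα τ τ' hτ => ?_⟩
        · by_cases h : α.1 ≤ q.η
          · rw [hf_low α h]
            exact ⟨Or.inl (q.f_mem _ τ), q.f_dom _ τ⟩
          · rw [hf_top α h, hsucc α h]
            exact hsn _ (hg τ) _
        · have h1 : α.1 ≤ q.η := Order.le_of_lt_succ (lt_of_lt_of_le hαβ β.2)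
          by_cases h : β.1 ≤ q.η
          · rw [hf_low α h1, hf_low β h]
            exact q.path.ascent _ _ hαβ
          · rw [hf_low α h1, hf_top β h]
            refine GenBy.superset (GenBy.inter hX hgF
              (q.f_sub_mem ⟨α.1, h1⟩ ⟨q.η, le_rfl⟩ h1)) ?_
            rintro τ ⟨e, k⟩
            change g τ = q.top τ at e
            refine Or.inl (Node.Sub.trans (t := g τ) ?_ (Node.sub_snoc _ _))
            rw [e]
            exact k
        · by_cases h : α.1 ≤ q.η
          · rw [hf_low α h]
            exact q.path.excl ⟨α.1, h⟩ hα τ τ' hτ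
          · rw [hf_top α h]
            exact (hgx τ τ' hτ).snoc ((hg τ).2.trans (hg τ').2.symm)
              fun e => hτ (Sum.inl_injective (hr e))
      closed := isClosedOrd_vanishingLevels htop
        (fun α hα => ⟨q.T, q.closed, fun t ht => hlow t (ht.trans (Order.le_of_lt_succ hα))⟩)
        (fun h => absurd h hnolim)
      top_vanishing := fun h => absurd h hnolim
      exclusive := by
        intro α hα t ht
        by_cases h : α.1 ≤ q.η
        · rw [hf_low α h]
          exact q.exclusive ⟨α.1, h⟩ hα t ⟨(hlow t (ht.2.le.trans h)).1 ht.1, ht.2⟩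
        · rw [hf_top α h]
          rcases ht with ⟨ht | ⟨t, ht, o, rfl⟩, htα⟩
          · exact absurd (htα ▸ q.height.2 t ht) h
          have h1 : {τ | t.Excl (q.top τ)} ∈ GenBy X := by
            by_cases hη : IsMin q.η
            · refine GenBy.superset GenBy.univ_mem fun τ _ ε h1 _ => ?_
              rw [ht.2] at h1
              exact absurd h1 (hη.not_lt)
            · exact q.exclusive ⟨q.η, le_rfl⟩ hη t ht
          -- The new last value `r o` is shared with at most one coordinate of the path, which the
          -- filter discards.
          have h2 : {τ | o ≠ .inl τ} ∈ GenBy X := by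
            cases o with
            | inr a => exact GenBy.superset GenBy.univ_mem fun τ _ => Sum.inr_ne_inl
            | inl σ =>
              exact GenBy.superset (GenBy.ne_mem hcap σ) fun τ hτ e =>
                hτ (Sum.inl_injective e).symm
          refine GenBy.superset (GenBy.inter hX (GenBy.inter hX h1 h2) hgF) ?_
          rintro τ ⟨⟨k1, k2⟩, e⟩
          change g τ = q.top τ at e
          change t.Excl (q.top τ) at k1
          rw [← e] at k1
          exact k1.snoc (ht.2.trans (hg τ).2.symm) fun e => k2 (hr e) }
  exact ⟨q', ⟨hlt.le, fun t => ⟨fun h => ⟨Or.inl h, q.height.2 t h⟩, fun h => (hlow t h.2).1 h.1⟩,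
    fun α hq hp => hf_low _ hq⟩, rfl, r, hr,
    fun τ => congrFun (hf_top ⟨Order.succ q.η, le_rfl⟩ hlt.not_ge) τ, fun a => hsn _ (hc a) _⟩

end SForcing
end Trees

/-! ### Conditions carrying branches, and limits of chains -/

section Trees
variable {K : Type u} [LinearOrder K] {Θ Z : Type u}

theorem exists_forall_lt_of_mk_lt (hκ : (#K).IsRegular) (hI : ∀ a : K, #(Set.Iic a) < #K)
    {ι : Type u} (hι : #ι < #K) (f : ι → K) : ∃ b, ∀ i, f i < b := by
  by_contra! h
  have hU : (⋃ i, Set.Iic (f i)) = Set.univ :=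
    Set.eq_univ_of_forall fun b => Set.mem_iUnion.2 (h b)
  have := (card_iUnion_lt_iff_forall_of_isRegular (t := fun i => Set.Iic (f i)) hκ hι).2
    fun i => hI _
  rw [hU, mk_univ] at this
  exact this.false

theorem exists_lub_of_mk_lt [WellFoundedLT K] (hκ : (#K).IsRegular)
    (hI : ∀ a : K, #(Set.Iic a) < #K) {ι : Type u} (hι : #ι < #K) (f : ι → K) :
    ∃ b, (∀ i, f i ≤ b) ∧ ∀ c < b, ∃ i, c < f i := by
  obtain ⟨b, hb, hmin⟩ := WellFounded.has_min (wellFounded_lt (α := K)) {b | ∀ i, f i ≤ b}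
    ((exists_forall_lt_of_mk_lt hκ hI hι f).imp fun b hb i => (hb i).le)
  refine ⟨b, hb, fun c hc => ?_⟩
  by_contra! h
  exact hmin c h hc

/-- A condition together with a family of nodes of its last level. These are meant to grow into
branches, some of which will vanish at limits. -/
structure BranchedCondition (K : Type u) [LinearOrder K] (X : Z → Set Θ) (A : Type u) :
    Type u where
  cond : SForcing K X
  branch : A → Node K
  branch_mem : ∀ a, branch a ∈ treeLevel cond.T cond.η
  pos : ¬ IsMin cond.η

namespace BranchedCondition
variable {X : Z → Set Θ} {A : Type u} {τ₀ : Θ} {C : Set A}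

/-- `s'` extends `s` coherently along the path and along the branches with index in `C`, the
branches in `C` get separated from the path and from each other, and they avoid all coordinates
of the path but `τ₀`. -/
structure Ext (τ₀ : Θ) (C : Set A) (s s' : BranchedCondition K X A) : Prop where
  le : s'.cond ≤ s.cond
  top : ∀ τ, (s.cond.top τ).Sub (s'.cond.top τ)
  branch : ∀ a ∈ C, (s.branch a).Sub (s'.branch a)
  sep : ∃ ε, s.cond.η ≤ ε ∧ ε < s'.cond.η ∧ ∀ a ∈ C,
    (∀ τ, (s'.cond.top τ).DiffAt (s'.branch a) ε) ∧
    ∀ a' ∈ C, a' ≠ a → (s'.branch a').DiffAt (s'.branch a) ε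
  avoid : ∀ a ∈ C, ∀ τ, τ ≠ τ₀ → ∀ ε, s.cond.η ≤ ε → (s'.branch a).DiffAt (s'.cond.top τ) ε

theorem branch_dom (s : BranchedCondition K X A) (a : A) : (s.branch a).dom = s.cond.η :=
  (s.branch_mem a).2

theorem Ext.trans {s t v : BranchedCondition K X A} (h : s.Ext τ₀ C t) (h' : t.Ext τ₀ C v) :
    s.Ext τ₀ C v where
  le := h'.le.trans h.le
  top τ := (h.top τ).trans (h'.top τ)
  branch a ha := (h.branch a ha).trans (h'.branch a ha)
  sep := h'.sep.imp fun _ hε => ⟨h.le.1.trans hε.1, hε.2⟩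
  avoid a ha τ hτ ε hε := by
    rcases lt_or_ge ε t.cond.η with hlt | hge
    · exact (h.avoid a ha τ hτ ε hε).of_sub (h'.branch a ha) (h'.top τ)
        (by rwa [branch_dom]) (by rwa [SForcing.top_dom])
    · exact h'.avoid a ha τ hτ ε hge

theorem Ext.mono {s t : BranchedCondition K X A} {C' : Set A} (h : s.Ext τ₀ C t) (hC : C' ⊆ C) :
    s.Ext τ₀ C' t where
  le := h.le
  top := h.top
  branch a ha := h.branch a (hC ha)
  sep := h.sep.imp fun _ hε => ⟨hε.1, hε.2.1, fun a ha => ⟨(hε.2.2 a (hC ha)).1,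
    fun a' ha' => (hε.2.2 a (hC ha)).2 a' (hC ha')⟩⟩
  avoid a ha := h.avoid a (hC ha)

theorem Ext.lt {s t : BranchedCondition K X A} (h : s.Ext τ₀ C t) : s.cond.η < t.cond.η :=
  let ⟨_, h1, h2, _⟩ := h.sep
  h1.trans_lt h2

theorem top_excl (s : BranchedCondition K X A) {τ τ' : Θ} (h : τ ≠ τ') :
    (s.cond.top τ).Excl (s.cond.top τ') := s.cond.path.excl _ s.pos τ τ' h

/-- Chains of length less than `κ` have a limit, in which one of the branches vanishes. The last
level of the limit consists of nodes that agree with the path or with one of the other branches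
from some level on. -/
theorem exists_limit [WellFoundedLT K] [SuccOrder K] [LinearOrder Z] [Nonempty Z]
    (hX : Antitone X) (hcap : ⋂ ξ, X ξ = ∅) (hκ : (#K).IsRegular) (hΘ : #Θ < #K)
    (hI : ∀ a : K, #(Set.Iic a) < #K) (hA : #A < #K)
    {J : Type u} [LinearOrder J] [Nonempty J] (hmax : ∀ j : J, ∃ k, j < k) (hJ : #J < #K)
    (g : J → BranchedCondition K X A) (hg : ∀ i j, i < j → (g i).Ext τ₀ C (g j))
    (ν : A) (hν : ν ∈ C) :
    ∃ s : BranchedCondition K X A, (∀ j, (g j).Ext τ₀ (C \ {ν}) s) ∧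
      ∀ t ∈ treeLevel s.cond.T s.cond.η, ∃ j, ∃ w ∈ (g j).cond.T,
        (∃ τ, t = w.star (s.cond.top τ)) ∨ ∃ a ∈ C \ {ν}, t = w.star (s.branch a) := by
  obtain ⟨j₀⟩ := ‹Nonempty J›
  obtain ⟨η, hle, hlub⟩ := exists_lub_of_mk_lt hκ hI hJ fun j => (g j).cond.η
  have hlt : ∀ j, (g j).cond.η < η := fun j =>
    let ⟨k, hk⟩ := hmax j
    (hg j k hk).lt.trans_le (hle k)
  have hcond : ∀ i j, i ≤ j → (g j).cond ≤ (g i).cond := fun i j h =>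
    h.lt_or_eq.elim (fun h => (hg i j h).le) (fun h => h ▸ le_rfl)
  have hmono : ∀ i j, i ≤ j → (g i).cond.η ≤ (g j).cond.η := fun i j h => (hcond i j h).1
  have hunion : ∀ n : J → Node K, (∀ j, (n j).dom = (g j).cond.η) →
      (∀ i j, i < j → (n i).Sub (n j)) → ∃ b : Node K, b.dom = η ∧ ∀ j, (n j).Sub b := by
    intro n hn hsub
    refine Node.exists_union n (fun i j h => ?_) η (fun ε hε => ?_) (fun j => ?_)
    · rcases h.lt_or_eq with h | rfl
      · exact hsub i j h
      · exact Node.Sub.refl _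
    · obtain ⟨j, hj⟩ := hlub ε hε
      exact ⟨j, by rwa [hn]⟩
    · rw [hn]
      exact hle j
  -- The union `c` of the branch `ν` is left out of the new tree and makes `η` a vanishing level.
  obtain ⟨c, hcd, hc⟩ := hunion (fun j => (g j).branch ν) (fun j => (g j).branch_dom ν)
    (fun i j h => (hg i j h).branch ν hν)
  let n : Θ ⊕ ↥(C \ {ν}) → J → Node K :=
    fun o j => Sum.elim (g j).cond.top (fun a => (g j).branch a.1) o
  have hn : ∀ o j, n o j ∈ treeLevel (g j).cond.T (g j).cond.η := by
    rintro (τ | a) j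
    · exact ⟨SForcing.top_mem _ _, SForcing.top_dom _ _⟩
    · exact (g j).branch_mem a.1
  have hnd : ∀ o j, (n o j).dom = (g j).cond.η := fun o j => (hn o j).2
  have hD : ∀ o, ∃ b : Node K, b.dom = η ∧ ∀ j, (n o j).Sub b := by
    refine fun o => hunion (n o) (hnd o) fun i j h => ?_
    rcases o with τ | a
    · exact (hg i j h).top τ
    · exact (hg i j h).branch a.1 a.2.1
  choose d hdd hd using hD
  set b : Θ → Node K := fun τ => d (.inl τ)
  have hbd : ∀ τ, (b τ).dom = η := fun τ => hdd _
  have hb : ∀ τ j, ((g j).cond.top τ).Sub (b τ) := fun τ j => hd (.inl τ) j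
  have hbx : ∀ τ τ', τ ≠ τ' → (b τ).Excl (b τ') := by
    intro τ τ' hτ ε h1 h2
    obtain ⟨j, hj⟩ := hlub ε (hbd τ ▸ h1)
    exact Node.DiffAt.of_sub (fun k1 k2 => (g j).top_excl hτ ε k1 k2) (hb τ j) (hb τ' j)
      (by rwa [SForcing.top_dom]) (by rwa [SForcing.top_dom]) h1 h2
  -- every new node avoids almost all of the path above each level of the chain
  have hdx : ∀ o, ∃ σ, ∀ τ, τ ≠ σ → ∀ j ε, (g j).cond.η ≤ ε → (d o).DiffAt (b τ) ε := by
    rintro (σ | a)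
    · exact ⟨σ, fun τ hτ j ε _ h1 h2 => hbx σ τ hτ.symm ε h1 h2⟩
    · refine ⟨τ₀, fun τ hτ j ε hε h1 h2 => ?_⟩
      obtain ⟨i, hi⟩ := hlub ε (hbd τ ▸ h2)
      have hji : j < i := by
        by_contra! h
        exact (hi.trans_le (hmono _ _ h)).not_ge hε
      exact Node.DiffAt.of_sub ((hg j i hji).avoid a.1 a.2.1 τ hτ ε hε) (hd (.inr a) i) (hb τ i)
        (by rwa [branch_dom]) (by rwa [SForcing.top_dom]) h1 h2
  -- every new node is separated from the vanishing branch cofinally often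
  have hsep : ∀ o j, ∃ ε, (g j).cond.η ≤ ε ∧ ε < η ∧ (d o).DiffAt c ε := by
    intro o j
    obtain ⟨k, hk⟩ := hmax j
    obtain ⟨ε, h1, h2, h3⟩ := (hg j k hk).sep
    have h4 : (n o k).DiffAt ((g k).branch ν) ε := by
      rcases o with τ | a
      · exact (h3 ν hν).1 τ
      · exact (h3 ν hν).2 a.1 a.2.1 a.2.2
    exact ⟨ε, h1, h2.trans (hlt k), h4.of_sub (hd o k) (hc k) (by rwa [hnd])
      (by rwa [branch_dom])⟩
  set L : Set (Node K) := ⋃ j, (g j).cond.T with hL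
  have hmemL : ∀ t, t ∈ L ↔ ∃ j, t ∈ (g j).cond.T := fun t => Set.mem_iUnion
  have hLdom : ∀ t ∈ L, t.dom < η := fun t ht => by
    obtain ⟨j, hj⟩ := (hmemL t).1 ht
    exact ((g j).cond.height.2 t hj).trans_lt (hlt j)
  have hup : ∀ i j t, i ≤ j → t ∈ (g i).cond.T → t ∈ (g j).cond.T := fun i j t h ht =>
    SForcing.mem_of_le (hcond i j h) ht
  have hLj : ∀ t j, t.dom ≤ (g j).cond.η → (t ∈ L ↔ t ∈ (g j).cond.T) := by
    refine fun t j h => ⟨fun ht => ?_, fun ht => (hmemL t).2 ⟨j, ht⟩⟩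
    obtain ⟨i, hi⟩ := (hmemL t).1 ht
    rcases le_total i j with hij | hij
    · exact hup i j t hij hi
    · exact (SForcing.mem_iff_of_le (hcond j i hij) h).1 hi
  -- initial segments of `w * (union of a chain through the tree)` are in the tree
  have hseg : ∀ w ∈ L, ∀ (n : J → Node K) (d : Node K), (∀ j, n j ∈ treeLevel (g j).cond.T
      (g j).cond.η) → (∀ j, (n j).Sub d) → ∀ s : Node K, s.Sub (w.star d) → s.dom < η → s ∈ L := by
    intro w hw n d hn hd s hs hsd
    obtain ⟨i, hi⟩ := (hmemL w).1 hw
    obtain ⟨j, hj⟩ := hlub s.dom hsd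
    have hk := hup i (max i j) w (le_max_left _ _) hi
    refine (hmemL s).2 ⟨max i j, (g _).cond.tree _ ((g _).cond.homogeneous w hk _ (hn _).1) s ?_⟩
    refine hs.of_common ((hd (max i j)).star_right w) ?_
    change s.dom ≤ (n (max i j)).dom
    rw [(hn _).2]
    exact hj.le.trans (hmono _ _ (le_max_right _ _))
  -- Homogeneity requires all nodes `w * d o` as soon as the `d o` are added; nothing else is put on
  -- the last level.
  set T : Set (Node K) := L ∪ {t | ∃ w ∈ L, ∃ o, t = w.star (d o)} with hT
  have hTL : ∀ t, t.dom < η → (t ∈ T ↔ t ∈ L) := by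
    refine fun t ht => ⟨?_, Or.inl⟩
    rintro (h | ⟨w, hw, o, rfl⟩)
    · exact h
    · exact absurd (hdd o) ht.ne
  have htree : IsTree T := by
    rintro t (ht | ⟨w, hw, o, rfl⟩) s hs
    · obtain ⟨j, hj⟩ := (hmemL t).1 ht
      exact Or.inl ((hmemL s).2 ⟨j, (g j).cond.tree t hj s hs⟩)
    · rcases lt_or_ge s.dom η with h | h
      · exact Or.inl (hseg w hw (n o) (d o) (hn o) (hd o) s hs h)
      · rw [hs.eq_of_dom_le ((hdd o).le.trans h)]
        exact Or.inr ⟨w, hw, o, rfl⟩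
  have hdT : ∀ o, d o ∈ treeLevel T η := fun o =>
    ⟨Or.inr ⟨_, (hmemL _).2 ⟨j₀, (hn o j₀).1⟩, o, ((hd o j₀).star_eq).symm⟩, hdd o⟩
  have htop : HasTopLevel T η := by
    refine ⟨⟨_, hdT (.inl τ₀)⟩, ?_⟩
    rintro t (ht | ⟨w, hw, o, rfl⟩)
    · exact (hLdom t ht).le
    · exact (hdd o).le
  have hij : ∀ α < η, ∃ j, α ≤ (g j).cond.η := fun α hα => (hlub α hα).imp fun _ h => h.le
  choose! ix hix using hij
  set f : Set.Iic η → Θ → Node K := fun α τ =>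
    if h : α.1 < η then (g (ix α.1)).cond.f ⟨α.1, hix α.1 h⟩ τ else b τ
  have hf_low : ∀ (α : Set.Iic η) j (h : α.1 ≤ (g j).cond.η), f α = (g j).cond.f ⟨α.1, h⟩ := by
    intro α j h
    have h1 : α.1 < η := h.trans_lt (hlt j)
    have h2 : f α = (g (ix α.1)).cond.f ⟨α.1, hix α.1 h1⟩ := funext fun τ => dif_pos h1
    rw [h2]
    rcases le_total (ix α.1) j with h3 | h3
    · exact (SForcing.f_eq_of_le (hcond _ _ h3) (hix α.1 h1)).symm
    · exact SForcing.f_eq_of_le (hcond _ _ h3) h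
  have hf_top : ∀ (α : Set.Iic η) (_ : α.1 = η), f α = b := fun α h =>
    funext fun τ => dif_neg h.not_lt
  have hcase : ∀ α : Set.Iic η, (∃ j, α.1 ≤ (g j).cond.η) ∨ α.1 = η := fun α =>
    (Set.mem_Iic.1 α.2).lt_or_eq.imp (fun h => ⟨_, hix _ h⟩) id
  -- Through `x` passes `x * c`. If it equalled some `w * d o`, then `c` and `d o` would agree above
  -- the domains of `x` and `w`, against `hsep`.
  have hvan : Order.IsSuccLimit η → η ∈ vanishingLevels T := by
    refine fun hη => ⟨hη, fun x hx hxη => ⟨x.star c, ⟨hcd, fun s hs hsd => ?_, ?_⟩,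
      Node.sub_star (hcd.symm ▸ hxη.le)⟩⟩
    · exact Or.inl (hseg x ((hTL x hxη).1 hx) (fun j => (g j).branch ν) c
        (fun j => (g j).branch_mem ν) hc s hs hsd)
    · rintro (h | ⟨w, hw, o, e⟩)
      · exact (hLdom _ h).ne hcd
      · obtain ⟨i, hi⟩ := hlub _ hxη
        obtain ⟨j, hj⟩ := hlub _ (hLdom w hw)
        obtain ⟨ε, h1, h2, h3⟩ := hsep o (max i j)
        have hxε : x.dom ≤ ε := hi.le.trans ((hmono _ _ (le_max_left _ _)).trans h1)
        have hwε : w.dom ≤ ε := hj.le.trans ((hmono _ _ (le_max_right _ _)).trans h1)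
        have h4 := h3.star hwε hxε
        rw [e] at h4
        have h5 : ε < (w.star (d o)).dom := h2.trans_eq (hdd o).symm
        exact h4 h5 h5 rfl
  have hΘC : #(Θ ⊕ ↥(C \ {ν})) < #K := by
    rw [mk_sum, lift_id, lift_id]
    exact add_lt_of_lt hκ.aleph0_le hΘ ((mk_set_le _).trans_lt hA)
  let p : SForcing K X :=
    { T := T
      η := η
      f := f
      tree := htree
      height := htop
      normal := by
        intro x hx α hα
        rcases hα.lt_or_eq with hα | rfl
        · rcases lt_or_ge x.dom η with h | h
          · obtain ⟨i, hi⟩ := (hmemL x).1 ((hTL x h).1 hx)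
            obtain ⟨j, hj⟩ := hlub α hα
            obtain ⟨y, hy, k⟩ := (g (max i j)).cond.normal x (hup i _ x (le_max_left _ _) hi) α
              (hj.le.trans (hmono _ _ (le_max_right _ _)))
            exact ⟨y, ⟨Or.inl ((hmemL y).2 ⟨_, hy.1⟩), hy.2⟩, k⟩
          · exact ⟨x.restrict α (hα.le.trans h), ⟨htree.restrict_mem hx _, rfl⟩,
              Or.inr (x.restrict_sub _ _)⟩
        · rcases lt_or_ge x.dom α with h | h
          · exact ⟨x.star (b τ₀), ⟨Or.inr ⟨x, (hTL x h).1 hx, .inl τ₀, rfl⟩, hbd τ₀⟩,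
              Or.inl (Node.sub_star ((hbd τ₀).symm ▸ h.le))⟩
          · exact ⟨x, ⟨hx, le_antisymm (htop.2 x hx) h⟩, Or.inl (Node.Sub.refl _)⟩
      homogeneous := by
        intro s hs t ht
        rcases le_or_gt t.dom s.dom with h | h
        · exact htree s hs _ (Node.star_sub_left h)
        · have hs := (hTL s (h.trans_le (htop.2 t ht))).1 hs
          obtain ⟨i, hi⟩ := (hmemL s).1 hs
          rcases ht with ht | ⟨w, hw, o, rfl⟩
          · obtain ⟨j, hj⟩ := (hmemL t).1 ht
            exact Or.inl ((hmemL _).2 ⟨max i j, (g _).cond.homogeneous s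
              (hup i _ s (le_max_left _ _) hi) t (hup j _ t (le_max_right _ _) hj)⟩)
          · rcases le_total s.dom w.dom with h' | h'
            · rw [Node.star_assoc_of_le h']
              obtain ⟨j, hj⟩ := (hmemL w).1 hw
              exact Or.inr ⟨_, (hmemL _).2 ⟨max i j, (g _).cond.homogeneous s
                (hup i _ s (le_max_left _ _) hi) w (hup j _ w (le_max_right _ _) hj)⟩, o, rfl⟩
            · rw [Node.star_star_of_le h']
              exact Or.inr ⟨s, hs, o, rfl⟩
      narrow := by
        intro α
        rcases lt_or_ge α η with hα | hα
        · obtain ⟨j, hj⟩ := hlub α hα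
          refine (mk_le_mk_of_subset ?_).trans_lt ((g j).cond.narrow α)
          intro t ht
          exact ⟨(hLj t j (ht.2.le.trans hj.le)).1 ((hTL t (ht.2.trans_lt hα)).1 ht.1), ht.2⟩
        · have hsub : treeLevel T α ⊆ Set.range fun x : L × (Θ ⊕ ↥(C \ {ν})) => x.1.1.star (d x.2) := by
            rintro t ⟨ht | ⟨w, hw, o, rfl⟩, htα⟩
            · exact absurd (hLdom t ht) (htα ▸ hα).not_gt
            · exact ⟨(⟨w, hw⟩, o), rfl⟩
          refine (mk_le_mk_of_subset hsub).trans_lt (mk_range_le.trans_lt ?_)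
          rw [mk_prod, lift_id, lift_id]
          refine mul_lt_of_lt hκ.aleph0_le ?_ hΘC
          rw [hL, card_iUnion_lt_iff_forall_of_isRegular hκ hJ]
          exact fun j => (g j).cond.mk_tree_lt hκ hI
      path := by
        refine ⟨fun α τ => ?_, fun α β hαβ => ?_, fun α hα τ τ' hτ => ?_⟩
        · rcases hcase α with ⟨j, h⟩ | h
          · rw [hf_low α j h]
            exact ⟨Or.inl ((hmemL _).2 ⟨j, SForcing.f_mem _ _ τ⟩), SForcing.f_dom _ _ τ⟩
          · rw [hf_top α h, h]
            exact hdT (.inl τ)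
        · rcases hcase β with ⟨j, h⟩ | h
          · have h1 : α.1 ≤ (g j).cond.η := (show α.1 ≤ β.1 from hαβ.le).trans h
            rw [hf_low α j h1, hf_low β j h]
            exact (g j).cond.path.ascent _ _ hαβ
          · obtain ⟨j, hj⟩ : ∃ j, α.1 ≤ (g j).cond.η := ⟨_, hix _ (lt_of_lt_of_eq hαβ h)⟩
            rw [hf_low α j hj, hf_top β h]
            refine GenBy.superset ((g j).cond.f_sub_mem ⟨α.1, hj⟩ ⟨(g j).cond.η, le_rfl⟩ hj) ?_
            exact fun τ k => Or.inl (Node.Sub.trans k (hb τ j))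
        · rcases hcase α with ⟨j, h⟩ | h
          · rw [hf_low α j h]
            exact (g j).cond.path.excl ⟨α.1, h⟩ hα τ τ' hτ
          · rw [hf_top α h]
            exact hbx τ τ' hτ
      closed := isClosedOrd_vanishingLevels htop (fun α hα => by
          obtain ⟨j, hj⟩ := hlub α hα
          exact ⟨(g j).cond.T, (g j).cond.closed, fun t ht =>
            (hTL t (ht.trans_lt hα)).trans (hLj t j (ht.trans hj.le))⟩) hvan
      top_vanishing := hvan
      exclusive := by
        intro α hα t ht
        rcases hcase α with ⟨j, h⟩ | h
        · rw [hf_low α j h]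
          exact (g j).cond.exclusive ⟨α.1, h⟩ hα t
            ⟨(hLj t j (ht.2.le.trans h)).1 ((hTL t (ht.2.trans_lt (h.trans_lt (hlt j)))).1 ht.1),
              ht.2⟩
        · rw [hf_top α h]
          rcases ht with ⟨ht | ⟨w, hw, o, rfl⟩, htα⟩
          · exact absurd (htα.trans h) (hLdom t ht).ne
          -- Below the height of the `j`-th condition exclusivity is inherited from it; above, `w`
          -- has no influence and `d o` can meet only the coordinate `σ`.
          obtain ⟨j, hj⟩ := (hmemL w).1 hw
          obtain ⟨σ, hσ⟩ := hdx o
          have hwj := (g j).cond.height.2 w hj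
          have h1 := (g j).cond.exclusive ⟨_, le_rfl⟩ (g j).pos (w.star (n o j))
            ⟨(g j).cond.homogeneous w hj _ (hn o j).1, hnd o j⟩
          refine GenBy.superset (GenBy.inter hX h1 (GenBy.ne_mem hcap σ)) ?_
          rintro τ ⟨k1, k2⟩ ε h1 h2
          rcases lt_or_ge ε (g j).cond.η with hε | hε
          · exact Node.DiffAt.of_sub (fun l1 l2 => k1 ε l1 l2) ((hd o j).star_right w) (hb τ j)
              (hε.trans_eq (hnd o j).symm) (hε.trans_eq (SForcing.top_dom _ τ).symm) h1 h2
          · rw [Node.star_val_of_le (hwj.trans hε)]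
            exact hσ τ k2 j ε hε h1 h2 }
  have hptop : p.top = b := hf_top ⟨η, le_rfl⟩ rfl
  have hple : ∀ j, p ≤ (g j).cond := fun j => by
    refine ⟨hle j, fun t => ⟨fun h => ?_, fun h => ?_⟩, fun α hq hp => hf_low _ j hq⟩
    · exact ⟨Or.inl ((hmemL t).2 ⟨j, h⟩), (g j).cond.height.2 t h⟩
    · exact (hLj t j h.2).1 ((hTL t (h.2.trans_lt (hlt j))).1 h.1)
  classical
  let s : BranchedCondition K X A :=
    { cond := p
      -- `b τ₀` is a dummy value for the branches that are no longer continued.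
      branch := fun a => if h : a ∈ C \ {ν} then d (.inr ⟨a, h⟩) else b τ₀
      branch_mem := fun a => by
        by_cases h : a ∈ C \ {ν}
        · rw [dif_pos h]
          exact hdT _
        · rw [dif_neg h]
          exact hdT (.inl τ₀)
      pos := fun h => h.not_lt (hlt j₀) }
  have hsb : ∀ (a : A) (h : a ∈ C \ {ν}), s.branch a = d (.inr ⟨a, h⟩) := fun a h => dif_pos h
  refine ⟨s, fun j => ⟨hple j, fun τ => ?_, fun a ha => ?_, ?_, fun a ha τ hτ ε hε => ?_⟩, ?_⟩
  · rw [show s.cond.top = b from hptop]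
    exact hb τ j
  · rw [hsb a ha]
    exact hd (.inr ⟨a, ha⟩) j
  · obtain ⟨k, hk⟩ := hmax j
    obtain ⟨ε, h1, h2, h3⟩ := (hg j k hk).sep
    have h4 : ∀ a, ε < ((g k).branch a).dom := fun a => by rwa [branch_dom]
    refine ⟨ε, h1, h2.trans (hlt k), fun a ha => ⟨fun τ => ?_, fun a' ha' hne => ?_⟩⟩
    · rw [show s.cond.top = b from hptop, hsb a ha]
      exact ((h3 a ha.1).1 τ).of_sub (hb τ k) (hd (.inr ⟨a, ha⟩) k) (by rwa [SForcing.top_dom])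
        (h4 _)
    · rw [hsb a ha, hsb a' ha']
      exact ((h3 a ha.1).2 a' ha'.1 hne).of_sub (hd (.inr ⟨a', ha'⟩) k) (hd (.inr ⟨a, ha⟩) k)
        (h4 _) (h4 _)
  · rw [show s.cond.top = b from hptop, hsb a ha]
    intro h1 h2
    obtain ⟨i, hi⟩ := hlub ε (hbd τ ▸ h2)
    have hji : j < i := by
      by_contra! h
      exact (hi.trans_le (hmono _ _ h)).not_ge hε
    exact Node.DiffAt.of_sub ((hg j i hji).avoid a ha.1 τ hτ ε hε) (hd (.inr ⟨a, ha⟩) i) (hb τ i)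
      (by rwa [branch_dom]) (by rwa [SForcing.top_dom]) h1 h2
  · rintro t ⟨ht | ⟨w, hw, o, rfl⟩, htd⟩
    · exact absurd htd (hLdom t ht).ne
    · obtain ⟨j, hj⟩ := (hmemL w).1 hw
      refine ⟨j, w, hj, ?_⟩
      rcases o with τ | a
      · exact Or.inl ⟨τ, by rw [show s.cond.top = b from hptop]⟩
      · exact Or.inr ⟨a.1, a.2, by rw [hsb a.1 a.2]⟩

end BranchedCondition
end Trees

/-! ### Transfinite runs meeting a sequence of tasks -/

/-- Transfinite recursion along a well-order, with prescribed steps at successors and limits, for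
a relation that is to hold between any two terms of the resulting sequence. -/
theorem exists_transfinite_chain {J : Type*} [LinearOrder J] [WellFoundedLT J] [SuccOrder J]
    {S : Type*} (s₀ : S) (R : J → J → S → S → Prop) (Step : J → S → S → Prop)
    (Lim : (j : J) → (Set.Iio j → S) → S → Prop)
    (htrans : ∀ i j k a b c, i < j → j < k → R i j a b → R j k b c → R i k a c)
    (hstep : ∀ j, ¬ IsMax j → ∀ s, ∃ s', Step j s s' ∧ R j (Order.succ j) s s')
    (hlim : ∀ j, Order.IsSuccLimit j → ∀ g : Set.Iio j → S,
      (∀ i k : Set.Iio j, i < k → R i k (g i) (g k)) →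
      ∃ s, Lim j g s ∧ ∀ i : Set.Iio j, R i j (g i) s) :
    ∃ F : J → S, (∀ j, IsMin j → F j = s₀) ∧ (∀ i j, i < j → R i j (F i) (F j)) ∧
      (∀ j, ¬ IsMax j → Step j (F j) (F (Order.succ j))) ∧
      ∀ j, Order.IsSuccLimit j → Lim j (fun i => F i) (F j) := by
  classical
  let Q : (j : J) → (Set.Iio j → S) → S → Prop := fun j g s =>
    (IsMin j → s = s₀) ∧ (∀ i : Set.Iio j, Order.succ i.1 = j → Step i (g i) s) ∧
      (Order.IsSuccLimit j → Lim j g s) ∧ ∀ i : Set.Iio j, R i j (g i) s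
  have hQ : ∀ j (g : Set.Iio j → S), (∀ i k : Set.Iio j, i < k → R i k (g i) (g k)) →
      ∃ s, Q j g s := by
    intro j g hg
    by_cases hmin : IsMin j
    · exact ⟨s₀, fun _ => rfl, fun i => absurd i.2 hmin.not_lt, fun h => absurd hmin h.1,
        fun i => absurd i.2 hmin.not_lt⟩
    by_cases hl : Order.IsSuccLimit j
    · obtain ⟨s, h1, h2⟩ := hlim j hl g hg
      refine ⟨s, fun h => absurd h hmin, fun i hi => ?_, fun _ => h1, h2⟩
      exact absurd (Order.IsSuccLimit.isMax (a := i.1) (hi.symm ▸ hl)) (not_isMax_iff.2 ⟨j, i.2⟩)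
    · obtain ⟨i, hij⟩ : ∃ i, i ⋖ j := by
        by_contra! h
        exact hl ⟨hmin, h⟩
      obtain rfl : Order.succ i = j := hij.succ_eq
      have hlt : i < Order.succ i := hij.lt
      have hi : ¬ IsMax i := hlt.not_isMax
      obtain ⟨s, h1, h2⟩ := hstep i hi (g ⟨i, hlt⟩)
      refine ⟨s, fun h => absurd h hmin, fun k hk => ?_, fun h => absurd h hl, fun k => ?_⟩
      · have hki : k = ⟨i, hlt⟩ := by
          refine Subtype.ext (le_antisymm (Order.le_of_lt_succ k.2) ?_)
          by_contra! hlt'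
          exact (Order.succ_le_of_lt hlt').not_gt (hlt.trans_eq hk.symm)
        rw [hki]
        exact h1
      · rcases (Order.le_of_lt_succ k.2).lt_or_eq with h | h
        · exact htrans _ _ _ _ _ _ h hlt (hg k ⟨i, hlt⟩ h) h2
        · obtain rfl : k = ⟨i, hlt⟩ := Subtype.ext h
          exact h2
  -- The default `s₀` of the recursion is never reached: `key` shows inductively that a term
  -- satisfying `Q` exists.
  let F : J → S := (wellFounded_lt (α := J)).fix fun j rec =>
    if h : ∃ s, Q j (fun i => rec i.1 i.2) s then h.choose else s₀
  have hF : ∀ j, F j = if h : ∃ s, Q j (fun i => F i.1) s then h.choose else s₀ := fun j =>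
    WellFounded.fix_eq _ _ j
  have key : ∀ j, Q j (fun i => F i.1) (F j) := by
    intro j
    induction j using WellFoundedLT.induction with
    | ind j ih =>
      have h := hQ j (fun i => F i.1) fun i k hik => (ih k k.2).2.2.2 ⟨i, hik⟩
      rw [hF j, dif_pos h]
      exact h.choose_spec
  exact ⟨F, fun j => (key j).1, fun i j h => (key j).2.2.2 ⟨i, h⟩,
    fun j hj => (key _).2.1 ⟨j, Order.lt_succ_of_not_isMax hj⟩ rfl, fun j => (key j).2.2.1⟩

section Trees
variable {K : Type u} [LinearOrder K] {Θ Z : Type u} {X : Z → Set Θ}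

/-- `p'` is a proper extension of `p` whose last function extends that of `p` everywhere. -/
structure SForcing.Coh (p p' : SForcing K X) : Prop where
  le : p' ≤ p
  top : ∀ τ, (p.top τ).Sub (p'.top τ)
  lt : p.η < p'.η

namespace BranchedCondition
variable {A : Type u} {τ₀ : Θ} {C : Set A}

theorem Ext.coh {s t : BranchedCondition K X A} (h : s.Ext τ₀ C t) : s.cond.Coh t.cond :=
  ⟨h.le, h.top, h.lt⟩

variable [SuccOrder K] [NoMaxOrder K] [LinearOrder Z] [Nonempty Z]

/-- The branches follow the coordinate `τ₀` of `g`, hence avoid all others, and the injective new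
values separate everything at `q.η`. An arbitrary `g` is allowed because `q.top` need not extend
`s.cond.top` at every coordinate. -/
theorem exists_ext (hX : Antitone X) (hcap : ⋂ ξ, X ξ = ∅) (hκ : (#K).IsRegular) (hΘ : #Θ < #K)
    (hA : #A < #K) (τ₀ : Θ) (s : BranchedCondition K X A) (q : SForcing K X) (hq : q ≤ s.cond)
    (g : Θ → Node K) (hg : ∀ τ, g τ ∈ treeLevel q.T q.η) (hgF : {τ | g τ = q.top τ} ∈ GenBy X)
    (hgx : ∀ τ τ', τ ≠ τ' → (g τ).Excl (g τ')) (hgs : ∀ τ, (s.cond.top τ).Sub (g τ)) :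
    ∃ s' : BranchedCondition K X A, s.Ext τ₀ Set.univ s' ∧ s'.cond ≤ q ∧
      (∀ τ, (g τ).Sub (s'.cond.top τ)) ∧ q.η < s'.cond.η := by
  have : Nonempty Θ := ⟨τ₀⟩
  have hlt : q.η < Order.succ q.η := Order.lt_succ _
  have hc : ∀ a, (s.branch a).star (g τ₀) ∈ treeLevel q.T q.η := fun a =>
    ⟨q.homogeneous _ (SForcing.mem_of_le hq (s.branch_mem a).1) _ (hg τ₀).1, (hg τ₀).2⟩
  obtain ⟨q', hq', hη, r, hr, htop, hbr⟩ := q.exists_succ hX hcap hκ hΘ hA g hg hgF hgx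
    (fun a => (s.branch a).star (g τ₀)) hc
  have hval : ∀ (t : Node K), t.dom = q.η → ∀ a h, (t.snoc a).val q.η h = a := by
    intro t ht a h
    exact dif_neg (ht.symm ▸ lt_irrefl _)
  let s' : BranchedCondition K X A :=
    { cond := q'
      branch := fun a => ((s.branch a).star (g τ₀)).snoc (r (.inr a))
      branch_mem := hbr
      pos := fun h => h.not_lt (hη ▸ hlt) }
  refine ⟨s', ⟨hq'.trans hq, fun τ => ?_, fun a _ => ?_, ⟨q.η, hq.1, hη ▸ hlt, fun a _ =>
    ⟨fun τ => ?_, fun a' _ hne => ?_⟩⟩, fun a _ τ hτ ε hε => ?_⟩, hq', fun τ => ?_, hη ▸ hlt⟩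
  · rw [htop]
    exact (hgs τ).trans (Node.sub_snoc _ _)
  · refine (Node.sub_star ?_).trans (Node.sub_snoc _ _)
    rw [branch_dom, (hg τ₀).2]
    exact hq.1
  · rw [htop]
    intro h1 h2
    rw [hval _ (hg τ).2, hval _ (hc a).2]
    exact fun e => Sum.inl_ne_inr (hr e)
  · intro h1 h2
    rw [hval _ (hc a').2, hval _ (hc a).2]
    exact fun e => hne (Sum.inr_injective (hr e))
  · rw [htop]
    have hx : ((s.branch a).star (g τ₀)).DiffAt (g τ) ε := fun h1 h2 => by
      rw [Node.star_val_of_le (by rwa [branch_dom])]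
      exact hgx τ₀ τ hτ.symm ε h1 h2
    intro h1 h2
    rcases lt_or_ge ε q.η with h | h
    · exact hx.of_sub (Node.sub_snoc _ _) (Node.sub_snoc _ _) (h.trans_eq (hc a).2.symm)
        (h.trans_eq (hg τ).2.symm) h1 h2
    · have h3 : ε ≤ q.η := by
        refine Order.le_of_lt_succ (h1.trans_eq ?_)
        exact congrArg Order.succ (hc a).2
      obtain rfl := le_antisymm h h3
      rw [hval _ (hc a).2, hval _ (hg τ).2]
      exact fun e => Sum.inr_ne_inl (hr e)
  · rw [htop]
    exact Node.sub_snoc _ _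

/-- A level is added only to make the height nonzero. The branches may all coincide, since
separation is demanded only of later extensions. -/
theorem exists_cond_le (A : Type u) [Nonempty Θ] (hX : Antitone X) (hcap : ⋂ ξ, X ξ = ∅)
    (hκ : (#K).IsRegular) (hΘ : #Θ < #K) (p : SForcing K X) :
    ∃ s : BranchedCondition K X A, s.cond ≤ p := by
  have hA : #PEmpty.{u + 1} < #K := by
    rw [mk_pempty]
    exact hκ.pos
  obtain ⟨q', hq', hη, -⟩ := p.exists_succ hX hcap hκ hΘ hA p.top
    (fun τ => ⟨p.top_mem τ, p.top_dom τ⟩) (GenBy.superset GenBy.univ_mem fun _ _ => rfl)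
    (fun τ τ' h => by
      by_cases hη : IsMin p.η
      · exact fun ε h1 => absurd (p.top_dom τ ▸ h1) hη.not_lt
      · exact p.path.excl _ hη τ τ' h) PEmpty.elim (fun a => a.elim)
  exact ⟨⟨q', fun _ => q'.top (Classical.arbitrary Θ), fun _ => ⟨q'.top_mem _, q'.top_dom _⟩,
    fun h => h.not_lt (hη ▸ Order.lt_succ _)⟩, hq'⟩

/-- A sequence of tasks, each of which can be met by a coherent extension of any given condition,
can be met successively along a coherent sequence of conditions. -/
theorem exists_run [WellFoundedLT K] (hX : Antitone X) (hcap : ⋂ ξ, X ξ = ∅)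
    (hκ : (#K).IsRegular) (hΘ : #Θ < #K) (hI : ∀ a : K, #(Set.Iic a) < #K) (hA : #A < #K)
    {J : Type u} [LinearOrder J] [WellFoundedLT J] [SuccOrder J] [OrderTop J] (hJ : #J < #K)
    (b : J) (hb : IsMin b) (hbt : b < ⊤) (s : BranchedCondition K X A)
    (Task : J → SForcing K X → SForcing K X → Prop)
    (hT : ∀ j < ⊤, ∀ s : BranchedCondition K X (A ⊕ J), ∃ s', s.Ext τ₀ Set.univ s' ∧
      Task j s.cond s'.cond) :
    ∃ (S : J → SForcing K X) (s' : BranchedCondition K X A), s.Ext τ₀ Set.univ s' ∧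
      S b = s.cond ∧ S ⊤ = s'.cond ∧ (∀ i j, i < j → (S i).Coh (S j)) ∧
      (∀ j < ⊤, Task j (S j) (S (Order.succ j))) ∧
      (IsEmpty A → Order.IsSuccLimit (⊤ : J) → ∀ t ∈ treeLevel (S ⊤).T (S ⊤).η,
        ∃ j < ⊤, ∃ w ∈ (S j).T, ∃ τ, t = w.star ((S ⊤).top τ)) := by
  have hAJ : #(A ⊕ J) < #K := by
    rw [mk_sum, lift_id, lift_id]
    exact add_lt_of_lt hκ.aleph0_le hA hJ
  let s₀ : BranchedCondition K X (A ⊕ J) :=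
    { cond := s.cond
      branch := Sum.elim s.branch fun _ => s.cond.top τ₀
      branch_mem := by
        rintro (a | j)
        · exact s.branch_mem a
        · exact ⟨s.cond.top_mem _, s.cond.top_dom _⟩
      pos := s.pos }
  -- The branches from `A` survive the whole run; the spare branch with index `k` is coherent only
  -- before stage `k`.
  let alive : J → Set (A ⊕ J) := fun j => {o | ∀ k, o = .inr k → j < k}
  have halive : ∀ i j, i ≤ j → alive j ⊆ alive i := fun i j h o ho k e => h.trans_lt (ho k e)
  obtain ⟨F, hF0, hFR, hFS, hFL⟩ := exists_transfinite_chain s₀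
    (fun _ j s s' => s.Ext τ₀ (alive j) s') (fun j s s' => Task j s.cond s'.cond)
    (fun j g s => ∀ t ∈ treeLevel s.cond.T s.cond.η, ∃ i, ∃ w ∈ (g i).cond.T,
        (∃ τ, t = w.star (s.cond.top τ)) ∨ ∃ a ∈ alive j, t = w.star (s.branch a))
    (fun i j k s t v _ hjk h h' => (h.mono (halive j k hjk.le)).trans h')
    (fun j hj s => by
      obtain ⟨s', h1, h2⟩ := hT j (lt_top_iff_ne_top.2 fun e => hj (e ▸ isMax_top)) s
      exact ⟨s', h2, h1.mono (Set.subset_univ _)⟩)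
    (fun j hj g hg => by
      -- `C` consists of `alive j` and `.inr j`, the branch chosen to vanish at the limit `j`.
      set C : Set (A ⊕ J) := {o | ∀ k, o = .inr k → j ≤ k} with hC
      have hsub : C \ {.inr j} ⊆ alive j := fun o ho k e =>
        (ho.1 k e).lt_of_ne fun h => ho.2 (h ▸ e)
      have hsub' : alive j ⊆ C \ {.inr j} := fun o ho =>
        ⟨fun k e => (ho k e).le, fun e => lt_irrefl j (ho j e)⟩
      obtain ⟨i, hi⟩ := not_isMin_iff.1 hj.1
      have : Nonempty (Set.Iio j) := ⟨⟨i, hi⟩⟩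
      obtain ⟨s, h1, h2⟩ := exists_limit (C := C) (τ₀ := τ₀) hX hcap hκ hΘ hI hAJ
        (J := Set.Iio j)
        (fun i => ⟨⟨_, hj.succ_lt i.2⟩, Order.lt_succ_of_not_isMax (not_isMax_iff.2 ⟨j, i.2⟩)⟩)
        ((mk_set_le _).trans_lt hJ) g
        (fun i k hik => (hg i k hik).mono fun o ho l e => lt_of_lt_of_le k.2 (ho l e))
        (.inr j) (fun k e => (Sum.inr_injective e).le)
      refine ⟨s, fun t ht => ?_, fun i => (h1 i).mono hsub'⟩
      obtain ⟨i, w, hw, h⟩ := h2 t ht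
      exact ⟨i, w, hw, h.imp id fun ⟨a, ha, e⟩ => ⟨a, hsub ha, e⟩⟩)
  have hE := hFR b ⊤ hbt
  rw [hF0 b hb] at hE
  have hinl : ∀ a : A, (Sum.inl a : A ⊕ J) ∈ alive ⊤ := fun a k e => absurd e Sum.inl_ne_inr
  let s' : BranchedCondition K X A :=
    { cond := (F ⊤).cond
      branch := fun a => (F ⊤).branch (.inl a)
      branch_mem := fun a => (F ⊤).branch_mem _
      pos := (F ⊤).pos }
  refine ⟨fun j => (F j).cond, s', ⟨hE.le, hE.top, fun a _ => hE.branch _ (hinl a), ?_,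
    fun a _ => hE.avoid _ (hinl a)⟩, congrArg cond (hF0 b hb), rfl, fun i j h => (hFR i j h).coh,
    fun j hj => hFS j hj.not_isMax, fun hAe htop t ht => ?_⟩
  · obtain ⟨ε, h1, h2, h3⟩ := hE.sep
    exact ⟨ε, h1, h2, fun a _ => ⟨(h3 _ (hinl a)).1, fun a' _ hne =>
      (h3 _ (hinl a)).2 _ (hinl a') fun e => hne (Sum.inl_injective e)⟩⟩
  -- With `A` empty no branch is alive at the top, so the path alone generates the last level.
  · obtain ⟨i, w, hw, h | ⟨a | k, ha, -⟩⟩ := hFL ⊤ htop t ht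
    · exact ⟨i, i.2, w, hw, h⟩
    · exact hAe.elim a
    · exact absurd (ha k rfl) not_top_lt

/-- The conditions of height above a given ordinal are dense. -/
theorem _root_.SForcing.exists_le_height [WellFoundedLT K] [Nonempty Θ] (hX : Antitone X)
    (hcap : ⋂ ξ, X ξ = ∅) (hκ : (#K).IsRegular) (hΘ : #Θ < #K)
    (hI : ∀ a : K, #(Set.Iic a) < #K) (p : SForcing K X) (α : K) : ∃ q ≤ p, α ≤ q.η := by
  obtain ⟨τ₀⟩ := ‹Nonempty Θ›
  have : Nonempty Θ := ⟨τ₀⟩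
  obtain ⟨s, hs⟩ := exists_cond_le (X := X) PEmpty.{u + 1} hX hcap hκ hΘ p
  obtain ⟨b, -, hb⟩ := WellFounded.has_min (wellFounded_lt (α := K)) Set.univ ⟨α, trivial⟩
  have hb : ∀ x, b ≤ x := fun x => not_lt.1 (hb x trivial)
  rcases (hb α).lt_or_eq with hbα | rfl
  swap
  · exact ⟨p, le_rfl, hb _⟩
  let : SuccOrder (Set.Iic α) := SuccOrder.ofLinearWellFoundedLT _
  obtain ⟨S, s', -, hSb, hSt, hcoh, -, -⟩ := exists_run (A := PEmpty.{u + 1}) (τ₀ := τ₀)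
    hX hcap hκ hΘ hI (by rw [mk_pempty]; exact hκ.pos) (J := Set.Iic α) (hI α) ⟨b, hb α⟩
    (fun x _ => hb x.1) (show b < α from hbα) s (fun _ _ _ => True)
    (fun j _ s => by
      obtain ⟨s', h1, -⟩ := exists_ext hX hcap hκ hΘ (by
          rw [mk_sum, lift_id, lift_id, mk_pempty, zero_add]
          exact hI α) τ₀ s s.cond le_rfl s.cond.top
        (fun τ => ⟨s.cond.top_mem τ, s.cond.top_dom τ⟩)
        (GenBy.superset GenBy.univ_mem fun _ _ => rfl) (fun _ _ => s.top_excl)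
        (fun _ => Node.Sub.refl _)
      exact ⟨s', h1, trivial⟩)
  -- Heights increase strictly along the run, so they dominate the index.
  have hle : ∀ i : Set.Iic α, i.1 ≤ (S i).η := by
    intro i
    induction i using WellFoundedLT.induction with
    | ind i ih =>
      by_contra! hlt
      have h := ih ⟨(S i).η, hlt.le.trans i.2⟩ hlt
      exact (hcoh _ i hlt).lt.not_ge h
  refine ⟨S ⊤, ?_, hle ⊤⟩
  have := (hcoh ⟨b, hb α⟩ ⊤ (show b < α from hbα)).le
  rw [hSb] at this
  exact this.trans hs

end BranchedCondition
end Trees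

/-! ### Catching a function of the path -/

theorem exists_injective_leftInvOn {Θ : Type u} {Y : Set Θ} (hY : #↥Yᶜ = #Θ) {σ : Θ → Θ}
    (hσ : Set.InjOn σ Y) : ∃ ρ : Θ → Θ, Function.Injective ρ ∧ ∀ τ ∈ Y, ρ (σ τ) = τ := by
  classical
  obtain ⟨j⟩ := hY.ge
  have hex : ∀ x ∈ σ '' Y, ∃ y ∈ Y, σ y = x := fun x hx => hx
  choose! ι hιY hι using hex
  -- The inverse of `σ` takes values in `Y`; the remaining points are sent injectively into the
  -- complement, which has room for them.
  refine ⟨fun x => if x ∈ σ '' Y then ι x else (j x : Θ), fun x x' h => ?_, fun τ hτ => ?_⟩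
  · simp only at h
    split_ifs at h with h1 h2 h2
    · rw [← hι x h1, h, hι x' h2]
    · exact absurd (h ▸ hιY x h1) (j x').2
    · exact absurd (h ▸ hιY x' h2) (j x).2
    · exact j.injective (Subtype.ext h)
  · have h1 : σ τ ∈ σ '' Y := Set.mem_image_of_mem σ hτ
    simp only [if_pos h1]
    exact hσ (hιY _ h1) hτ (hι _ h1)

section Trees
variable {K : Type u} [LinearOrder K] {Θ Z : Type u} {X : Z → Set Θ}

/-- If some extension `q` of `m` satisfies `D α q` for a function `q.f α` of the path that follows
`t * m.top ∘ σ` on `Y`, then already `m'` satisfies `D α m'` for some function `m'.f α` of its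
path that is followed by `t * m'.top ∘ σ` on `Y`. -/
def SForcing.Catches (D : K → SForcing K X → Prop) (Y : Set Θ) (t : Θ → Node K) (σ : Θ → Θ)
    (m m' : SForcing K X) : Prop :=
  (∃ q ≤ m, ∃ (α : K) (hα : α ≤ q.η), m.η ≤ α ∧ D α q ∧
    ∀ τ ∈ Y, (t τ).dom < m.η ∧ ((t τ).star (m.top (σ τ))).Sub (q.f ⟨α, hα⟩ τ)) →
  ∃ (α : K) (hα : α ≤ m'.η), α < m'.η ∧ D α m' ∧
    ∀ τ ∈ Y, (m'.f ⟨α, hα⟩ τ).Sub ((t τ).star (m'.top (σ τ)))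

namespace BranchedCondition
variable {A : Type u} {τ₀ : Θ}
variable [SuccOrder K] [NoMaxOrder K] [LinearOrder Z] [Nonempty Z]

theorem exists_ext_self (hX : Antitone X) (hcap : ⋂ ξ, X ξ = ∅) (hκ : (#K).IsRegular)
    (hΘ : #Θ < #K) (hA : #A < #K) (τ₀ : Θ) (s : BranchedCondition K X A) :
    ∃ s' : BranchedCondition K X A, s.Ext τ₀ Set.univ s' :=
  (exists_ext hX hcap hκ hΘ hA τ₀ s s.cond le_rfl s.cond.top
    (fun τ => ⟨s.cond.top_mem τ, s.cond.top_dom τ⟩)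
    (GenBy.superset GenBy.univ_mem fun _ _ => rfl) (fun _ _ => s.top_excl)
    (fun _ => Node.Sub.refl _)).imp fun _ h => h.1

/-- If a suitable `q` exists, coordinate `σ τ` of the last function is led along `v τ = q.f α τ`. On
filter-many coordinates `σ τ = τ` and `v τ ⊆ q.top τ`, so there `q.top` is kept and the ascent path
continues. -/
theorem exists_catches (hX : Antitone X) (hcap : ⋂ ξ, X ξ = ∅) (hκ : (#K).IsRegular)
    (hΘ : #Θ < #K) (hA : #A < #K) (τ₀ : Θ) (s : BranchedCondition K X A)
    (D : K → SForcing K X → Prop) (hD : ∀ α q q', q' ≤ q → D α q → D α q') (ξ : Z)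
    (hξ : #↥(X ξ)ᶜ = #Θ) (t : Θ → Node K) (σ : Θ → Θ) :
    ∃ s' : BranchedCondition K X A, s.Ext τ₀ Set.univ s' ∧
      SForcing.Catches D (X ξ) t σ s.cond s'.cond := by
  by_cases hex : ∃ q ≤ s.cond, ∃ (α : K) (hα : α ≤ q.η), s.cond.η ≤ α ∧ D α q ∧
    ∀ τ ∈ X ξ, (t τ).dom < s.cond.η ∧
      ((t τ).star (s.cond.top (σ τ))).Sub (q.f ⟨α, hα⟩ τ)
  swap
  · obtain ⟨s', h⟩ := exists_ext_self hX hcap hκ hΘ hA τ₀ s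
    exact ⟨s', h, fun h => absurd h hex⟩
  obtain ⟨q, hq, α, hα, hηα, hDq, ht⟩ := hex
  set v : Θ → Node K := q.f ⟨α, hα⟩
  have hvd : ∀ τ, (v τ).dom = α := fun τ => q.f_dom _ τ
  have hαmin : ¬ IsMin α := fun h => s.pos (h.mono hηα)
  have hvx : ∀ τ τ', τ ≠ τ' → (v τ).Excl (v τ') := q.path.excl ⟨α, hα⟩ hαmin
  have hqx : ∀ τ τ', τ ≠ τ' → (q.top τ).Excl (q.top τ') :=
    q.path.excl ⟨q.η, le_rfl⟩ fun h => s.pos (h.mono hq.1)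
  have hval : ∀ τ ∈ X ξ, ∀ ε (h : ε < (v τ).dom) (h' : ε < (s.cond.top (σ τ)).dom),
      (t τ).dom ≤ ε → (v τ).val ε h = (s.cond.top (σ τ)).val ε h' := by
    intro τ hτ ε h h' hε
    have h1 := (ht τ hτ).2.2 ε h' h
    exact h1.symm.trans (Node.star_val_of_le hε h')
  -- If `σ τ = σ τ'`, then `v τ` and `v τ'` share their value at the larger of the domains of `t τ`
  -- and `t τ'`.
  have hσ : Set.InjOn σ (X ξ) := by
    intro τ hτ τ' hτ' e
    by_contra hne
    have hmax : max (t τ).dom (t τ').dom < s.cond.η := max_lt (ht τ hτ).1 (ht τ' hτ').1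
    have hd : ∀ υ, max (t τ).dom (t τ').dom < (v υ).dom := fun υ =>
      (hmax.trans_le hηα).trans_eq (hvd υ).symm
    have hd' : ∀ υ, max (t τ).dom (t τ').dom < (s.cond.top υ).dom := fun υ =>
      hmax.trans_eq (s.cond.top_dom υ).symm
    refine hvx τ τ' hne _ (hd τ) (hd τ') ?_
    rw [hval τ hτ _ (hd τ) (hd' _) (le_max_left _ _),
      hval τ' hτ' _ (hd τ') (hd' _) (le_max_right _ _)]
    simp only [e]
  have hF1 : {τ | (s.cond.top τ).Sub (v τ)} ∈ GenBy X := by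
    have h1 := q.f_sub_mem ⟨s.cond.η, hq.1⟩ ⟨α, hα⟩ hηα
    rw [SForcing.f_eq_of_le hq le_rfl] at h1
    exact h1
  have hF2 : {τ | (v τ).Sub (q.top τ)} ∈ GenBy X := q.f_sub_mem ⟨α, hα⟩ ⟨q.η, le_rfl⟩ hα
  obtain ⟨ρ, hρ, hρσ⟩ := exists_injective_leftInvOn hξ hσ
  -- Beyond the domain of `t τ`, `v τ` follows both `s.cond.top τ` and `s.cond.top (σ τ)`, which are
  -- mutually exclusive unless the coordinates are equal.
  have hσfix : ∀ τ ∈ X ξ, (s.cond.top τ).Sub (v τ) → σ τ = τ := by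
    intro τ hτ hsub
    by_contra hne
    have h1 := (ht τ hτ).1
    have h2 : ∀ υ, (t τ).dom < (s.cond.top υ).dom := fun υ => h1.trans_eq (s.cond.top_dom υ).symm
    refine s.top_excl hne _ (h2 _) (h2 _) ?_
    rw [hsub.2 _ (h2 τ) ((h1.trans_le hηα).trans_eq (hvd τ).symm), hval τ hτ _ _ (h2 _) le_rfl]
  have hdom : ∀ τ, (v (ρ τ)).dom ≤ (q.top τ).dom := fun τ => by
    rwa [hvd, q.top_dom]
  -- The new function follows `s.cond.top τ` up to `s.cond.η`, then `v (ρ τ)` up to `α`, then `q.top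
  -- τ`. Injectivity of `ρ` keeps the middle segments exclusive.
  obtain ⟨s', h1, h2, h3, h4⟩ := exists_ext hX hcap hκ hΘ hA τ₀ s q hq
    (fun τ => (s.cond.top τ).star ((v (ρ τ)).star (q.top τ)))
    (fun τ => ⟨q.homogeneous _ (SForcing.mem_of_le hq (s.cond.top_mem τ)) _
      (q.homogeneous _ (q.f_mem _ _) _ (q.top_mem τ)), q.top_dom τ⟩)
    (by
      refine GenBy.superset (GenBy.inter hX ⟨ξ, subset_rfl⟩ (GenBy.inter hX hF1 hF2)) ?_
      rintro τ ⟨k1, k2, k3⟩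
      have e : ρ τ = τ := by
        have := hρσ τ k1
        rwa [hσfix τ k1 k2] at this
      change (s.cond.top τ).star ((v (ρ τ)).star (q.top τ)) = q.top τ
      rw [e, Node.Sub.star_eq k3, Node.Sub.star_eq (Node.Sub.trans k2 k3)])
    (fun τ τ' hne => (s.top_excl hne).star
      ((hvx _ _ fun e => hne (hρ e)).star (hqx τ τ' hne) ((hvd _).trans (hvd _).symm))
      ((s.cond.top_dom _).trans (s.cond.top_dom _).symm))
    (fun τ => Node.sub_star (by
      change _ ≤ (q.top τ).dom
      rw [s.cond.top_dom, q.top_dom]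
      exact hq.1))
  refine ⟨s', h1, fun _ => ⟨α, hα.trans h4.le, hα.trans_lt h4, hD α q _ h2 hDq, fun τ hτ => ?_⟩⟩
  rw [SForcing.f_eq_of_le h2 hα]
  refine Node.Sub.trans ?_ ((h3 (σ τ)).star_right (t τ))
  have h5 := hdom (σ τ)
  rw [hρσ τ hτ] at h5 ⊢
  have h6 : (v τ).Sub ((v τ).star (q.top (σ τ))) := Node.sub_star h5
  rw [Node.star_assoc_of_le (by rw [s.cond.top_dom]; exact (ht τ hτ).1.le),
    Node.Sub.star_eq ((ht τ hτ).2.trans h6)]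
  exact h6

end BranchedCondition

/-! ### Meeting an unbounded family twice -/

theorem mk_Iic_ord_toType_lt {c : Cardinal.{u}} (hc : ℵ₀ ≤ c) (a : c.ord.ToType) :
    #(Set.Iic a) < #c.ord.ToType := by
  rw [mk_ord_toType, ← Set.Iio_insert]
  refine (mk_insert_le).trans_lt (add_lt_of_lt hc ?_ (one_lt_aleph0.trans_le hc))
  simpa using mk_Iio_lt a

/-- If a family of sets of conditions is met above every ordinal, then some condition meets it
twice, at functions of its path that extend each other on the given sets `X (ξ w)`. -/
theorem SForcing.exists_sub_of_unbounded [WellFoundedLT K] [SuccOrder K] [NoMaxOrder K]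
    [LinearOrder Z] [Nonempty Z] [Infinite Θ] (hX : Antitone X) (hcap : ⋂ ξ, X ξ = ∅)
    (hκ : (#K).IsRegular) (hI : ∀ a : K, #(Set.Iic a) < #K)
    (hpow : ∀ μ : Cardinal.{u}, μ < #K → μ ^ #Θ < #K)
    (hcompl : ∀ ξ, #↥(X ξ)ᶜ = #Θ) {W : Type u} (hW : #W < #K) (ξ : W → Z)
    (D : W → K → SForcing K X → Prop) (hD : ∀ w α q q', q' ≤ q → D w α q → D w α q')
    (p : SForcing K X)
    (hp : ∀ q ≤ p, ∀ γ, ∃ r ≤ q, ∃ w α, γ ≤ α ∧ D w α r) :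
    ∃ q ≤ p, ∃ (w : W) (α β : K) (hα : α ≤ q.η) (hβ : β ≤ q.η), α < β ∧ D w α q ∧ D w β q ∧
      ∀ τ ∈ X (ξ w), (q.f ⟨α, hα⟩ τ).Sub (q.f ⟨β, hβ⟩ τ) := by
  have τ₀ : Θ := Classical.arbitrary Θ
  have h2 : (2 : Cardinal.{u}) < #K := hκ.nat_lt 2
  have hΘ2 : (2 : Cardinal.{u}) ^ #Θ < #K := hpow 2 h2
  have hΘ : #Θ < #K := (cantor _).trans hΘ2
  have hΘinf : ℵ₀ ≤ #Θ := aleph0_le_mk Θ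
  have hreg : (Order.succ #Θ).IsRegular := isRegular_succ hΘinf
  -- Length `θ⁺`: regular, so that `θ` many stages are bounded, and below `κ` because `θ⁺ ≤ 2^θ <
  -- κ`.
  let Ω := (Order.succ #Θ).ord.ToType
  have hΩ : #Ω = Order.succ #Θ := mk_ord_toType _
  have hΩK : #Ω < #K := by
    rw [hΩ]
    exact (Order.succ_le_of_lt (cantor _)).trans_lt hΘ2
  have : NoMaxOrder Ω := Cardinal.noMaxOrder hreg.aleph0_le
  have : Nonempty Ω := mk_ne_zero_iff.1 (by rw [hΩ]; exact hreg.pos.ne')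
  let : SuccOrder (WithTop Ω) := SuccOrder.ofLinearWellFoundedLT _
  have hmkTop : ∀ {I : Type u}, #I < #K → #(WithTop I) < #K := by
    intro I hI
    have : #(WithTop I) = #I + 1 := mk_option
    rw [this]
    exact add_lt_of_lt hκ.aleph0_le hI (one_lt_aleph0.trans_le hκ.aleph0_le)
  have hmin : ∀ {I : Type u} [LinearOrder I] [WellFoundedLT I] [Nonempty I],
      ∃ b : WithTop I, IsMin b ∧ b < ⊤ := by
    intro I _ _ _
    obtain ⟨b, -, hb⟩ := WellFounded.has_min (wellFounded_lt (α := I)) Set.univ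
      ⟨Classical.arbitrary I, trivial⟩
    refine ⟨b, fun x hx => ?_, WithTop.coe_lt_top b⟩
    induction x using WithTop.recTopCoe with
    | top => exact le_top
    | coe x => exact WithTop.coe_le_coe.2 (not_lt.1 (hb x trivial))
  obtain ⟨-, -, w₀, -, -, -⟩ := hp p le_rfl (p.η)
  -- A single step treats all triples `(w, t, σ)`; `n` and `n'` are the intermediate conditions
  -- between which the given triple is treated.
  let Task : SForcing K X → SForcing K X → Prop := fun m m' =>
    ∀ (w : W) (t : Θ → m.T) (σ : Θ → Θ), ∃ n n' : SForcing K X, n ≤ m ∧ n' ≤ n ∧ m' ≤ n' ∧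
      (∀ τ, (n.top τ).Sub (n'.top τ)) ∧ (∀ τ, (n'.top τ).Sub (m'.top τ)) ∧
      Catches (D w) (X (ξ w)) (fun τ => (t τ).1) σ n n'
  have hTask : ∀ {A : Type u}, #A < #K → ∀ s : BranchedCondition K X A,
      ∃ s', s.Ext τ₀ Set.univ s' ∧ Task s.cond s'.cond := by
    intro A hA s
    -- By `hpow` there are fewer than `κ` triples, so an inner run can list them while preserving
    -- the branches in `A`.
    let E := W × (Θ → s.cond.T) × (Θ → Θ)
    have hE : #E < #K := by
      have h1 : #(Θ → s.cond.T) < #K := by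
        rw [← power_def]
        exact hpow _ (s.cond.mk_tree_lt hκ hI)
      have h2 : #(Θ → Θ) < #K := by
        rw [← power_def]
        exact hpow _ hΘ
      rw [mk_prod, lift_id, lift_id, mk_prod, lift_id, lift_id]
      exact mul_lt_of_lt hκ.aleph0_le hW (mul_lt_of_lt hκ.aleph0_le h1 h2)
    let I := (#E).ord.ToType
    obtain ⟨e⟩ : Nonempty (I ≃ E) := Cardinal.eq.1 (mk_ord_toType _)
    have : Nonempty I := ⟨e.symm (w₀, fun _ => ⟨s.cond.top τ₀, s.cond.top_mem τ₀⟩, id)⟩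
    let : SuccOrder (WithTop I) := SuccOrder.ofLinearWellFoundedLT _
    have hIK : #(WithTop I) < #K := hmkTop (by rwa [mk_ord_toType])
    obtain ⟨b, hb, hbt⟩ := hmin (I := I)
    obtain ⟨S, s', hs', hSb, hSt, hcoh, hS, -⟩ := BranchedCondition.exists_run hX hcap hκ hΘ hI hA
      hIK b hb hbt s (τ₀ := τ₀) (fun j m m' => ∀ x : I, j = x →
        Catches (D (e x).1) (X (ξ (e x).1)) (fun τ => ((e x).2.1 τ).1) (e x).2.2 m m')
      (fun j hj s => by
        obtain ⟨x, rfl⟩ := WithTop.ne_top_iff_exists.1 hj.ne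
        obtain ⟨s', h1, h2⟩ := BranchedCondition.exists_catches hX hcap hκ hΘ (A := A ⊕ WithTop I)
          (by
            rw [mk_sum, lift_id, lift_id]
            exact add_lt_of_lt hκ.aleph0_le hA hIK) τ₀ s (D (e x).1) (hD _) (ξ (e x).1) (hcompl _)
          (fun τ => ((e x).2.1 τ).1) (e x).2.2
        refine ⟨s', h1, fun y hy => ?_⟩
        obtain rfl := WithTop.coe_injective hy
        exact h2)
    refine ⟨s', hs', fun w t σ => ?_⟩
    set x : I := e.symm (w, t, σ) with hx
    have hex : e x = (w, t, σ) := e.apply_symm_apply _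
    have hxt : (x : WithTop I) < ⊤ := WithTop.coe_lt_top x
    have hxs : (x : WithTop I) < Order.succ (x : WithTop I) :=
      Order.lt_succ_of_not_isMax hxt.not_isMax
    have hc := hS x hxt x rfl
    rw [hex] at hc
    have hle : ∀ i j, i ≤ j → S j ≤ S i ∧ ∀ τ, ((S i).top τ).Sub ((S j).top τ) := fun i j h =>
      h.lt_or_eq.elim (fun h => ⟨(hcoh i j h).le, (hcoh i j h).top⟩)
        (fun h => h ▸ ⟨le_rfl, fun _ => Node.Sub.refl _⟩)
    have hbx : b ≤ x := (le_total b x).elim id fun h => hb h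
    refine ⟨S x, S (Order.succ x), hSb ▸ (hle _ _ hbx).1, (hle _ _ hxs.le).1,
      hSt ▸ (hle _ _ le_top).1, (hle _ _ hxs.le).2, hSt ▸ (hle _ _ le_top).2, hc⟩
  obtain ⟨s, hs⟩ := BranchedCondition.exists_cond_le PEmpty.{u + 1} hX hcap hκ hΘ p
  have hP : #PEmpty.{u + 1} < #K := by
    rw [mk_pempty]
    exact hκ.pos
  obtain ⟨b, hb, hbt⟩ := hmin (I := Ω)
  obtain ⟨S, s', hs', -, hSt, hcoh, hS, hlim⟩ := BranchedCondition.exists_run hX hcap hκ hΘ hI hP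
    (hmkTop hΩK) b hb hbt s (τ₀ := τ₀) (fun _ => Task) (fun j _ s => hTask (by
      rw [mk_sum, lift_id, lift_id]
      exact add_lt_of_lt hκ.aleph0_le hP (hmkTop hΩK)) s)
  have htop : Order.IsSuccLimit (⊤ : WithTop Ω) := by
    refine ⟨fun h => h.not_lt hbt, fun j hj => ?_⟩
    obtain ⟨x, rfl⟩ := WithTop.ne_top_iff_exists.1 hj.lt.ne
    obtain ⟨y, hy⟩ := exists_gt x
    exact hj.2 (WithTop.coe_lt_coe.2 hy) (WithTop.coe_lt_top y)
  have hSp : S ⊤ ≤ p := hSt ▸ hs'.le.trans hs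
  obtain ⟨r₀, hr₀, w, β, hβ, hDβ⟩ := hp (S ⊤) hSp (S ⊤).η
  obtain ⟨r, hr, hβr⟩ := SForcing.exists_le_height hX hcap hκ hΘ hI r₀ β
  have hDβ := hD w β _ _ hr hDβ
  have hrS : r ≤ S ⊤ := hr.trans hr₀
  set v : Θ → Node K := r.f ⟨β, hβr⟩
  have hvd : ∀ τ, (v τ).dom = β := fun τ => r.f_dom _ τ
  have hres : ∀ τ, ∃ j < (⊤ : WithTop Ω), ∃ w ∈ (S j).T, ∃ σ,
      (v τ).restrict (S ⊤).η (hβ.trans_eq (hvd τ).symm) = w.star ((S ⊤).top σ) := fun τ =>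
    hlim inferInstance htop _ ⟨(mem_iff_of_le hrS le_rfl).1 (r.tree.restrict_mem (r.f_mem _ τ) _),
      rfl⟩
  choose j hj t ht σ hσ using hres
  have hj' : ∀ τ, ∃ x : Ω, (x : WithTop Ω) = j τ := fun τ =>
    WithTop.ne_top_iff_exists.1 (hj τ).ne
  choose x hx using hj'
  -- All `t τ` belong to the tree of stage `k`, so the step at `k` has treated the triple `(w, t,
  -- σ)`.
  obtain ⟨k, hk⟩ := exists_forall_lt_of_mk_lt (by rwa [hΩ]) (mk_Iic_ord_toType_lt hreg.aleph0_le)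
    (ι := Θ) (by rw [hΩ]; exact Order.lt_succ _) x
  have hkj : ∀ τ, j τ < k := fun τ => hx τ ▸ WithTop.coe_lt_coe.2 (hk τ)
  have hkt : (k : WithTop Ω) < ⊤ := WithTop.coe_lt_top k
  obtain ⟨n, n', h1, h2, h3, h4, h5, h6⟩ := hS k hkt w
    (fun τ => ⟨t τ, mem_of_le (hcoh _ _ (hkj τ)).le (ht τ)⟩) σ
  have hcs := hcoh (Order.succ k) ⊤ (htop.succ_lt hkt)
  have hrn' : r ≤ n' := hrS.trans (hcs.le.trans h3)
  have htopn' : ∀ τ, (n'.top τ).Sub ((S ⊤).top τ) := fun τ => (h5 τ).trans (hcs.top τ)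
  have hn'η : n'.η ≤ (S ⊤).η := (hcs.le.trans h3).1
  have hstar : ∀ τ, ((t τ).star ((S ⊤).top (σ τ))).Sub (v τ) := fun τ => by
    rw [← hσ τ]
    exact Node.restrict_sub _ _ _
  -- The later condition `r` with `β` witnesses the premise of `Catches`. The `α` obtained lies
  -- below `n'.η`, hence below `β`.
  obtain ⟨α, hα, hαn, hDα, hsub⟩ := h6 ⟨r, hrn'.trans h2, β, hβr, h2.1.trans (hn'η.trans hβ), hDβ,
    fun τ _ => ⟨((S (j τ)).height.2 _ (ht τ)).trans_lt ((hcoh _ _ (hkj τ)).lt.trans_le h1.1),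
      Node.Sub.trans (((h4 _).trans (htopn' _)).star_right _) (hstar τ)⟩⟩
  refine ⟨r, hrS.trans hSp, w, α, β, hα.trans hrn'.1, hβr, hαn.trans_le (hn'η.trans hβ),
    hD w α _ _ hrn' hDα, hDβ, fun τ hτ => ?_⟩
  rw [f_eq_of_le hrn' hα]
  exact (hsub τ hτ).trans (((htopn' _).star_right _).trans (hstar τ))

end Trees

/-! ### From compatible ordinals to the chain condition -/

namespace PName
variable {P : Type u} [Preorder P]

theorem ofFamily_sub {I J : Type u} {x : I → PName P} {y : J → PName P} {p : P}
    (h : ∀ i, ∃ j, x i = y j) : sub (ofFamily x) (ofFamily y) p := by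
  intro z q _ hz
  rw [mem_ofFamily] at hz ⊢
  intro r hr
  obtain ⟨s, hs, i, e⟩ := hz r hr
  obtain ⟨j, hj⟩ := h i
  exact ⟨s, hs, j, hj ▸ e⟩

end PName

section Generic
variable {K : Type u} [LinearOrder K] [WellFoundedLT K]
variable {Θ : Type u} [LinearOrder Θ] [WellFoundedLT Θ]

theorem nodeName_sub {P : Type u} [Preorder P] {s t : Node K} (h : s.Sub t) (p : P) :
    PName.sub (nodeName s) (nodeName t) p := by
  refine PName.ofFamily_sub fun ε => ⟨⟨ε.1, lt_of_lt_of_le ε.2 h.1⟩, ?_⟩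
  simp only
  rw [h.2 ε.1 ε.2 (lt_of_lt_of_le ε.2 h.1)]

theorem memSupp_nodeSeqName {P : Type u} [Preorder P] {g h : Θ → Node K} {τ : Θ}
    (hτ : (g τ).Sub (h τ)) {x : PName P} {p : P} (hx : PName.eq x (PName.ofOrd τ) p) :
    memSupp (nodeSeqName g) (nodeSeqName h) x p := by
  have hmem : ∀ (g : Θ → Node K), ∀ q ≤ p,
      PName.mem (PName.opair x (nodeName (g τ))) (nodeSeqName g) q := fun g q hq =>
    PName.mem_congr_left (PName.mem_ofFamily_self
      (fun τ : Θ => PName.opair (PName.ofOrd τ) (nodeName (g τ))) τ q)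
      (PName.opair_congr (PName.eq_symm (PName.eq_mono hx hq)) (PName.eq_refl _ _))
  intro q hq
  refine ⟨q, le_rfl, nodeName (g τ), fun r hr => ⟨r, le_rfl, nodeName (h τ),
    hmem g r (hr.trans hq), hmem h r (hr.trans hq), fun v _ => ⟨v, le_rfl, Or.inl ?_⟩⟩⟩
  exact nodeName_sub hτ v

variable {Z : Type u} {X : Z → Set Θ}

theorem opair_mem_genericPath (q : SForcing K X) (α : Set.Iic q.η) {r : SForcing K X}
    (hr : r ≤ q) : PName.mem (PName.opair (PName.ofOrd α.1) (nodeSeqName (q.f α)))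
      (genericPath K X) r :=
  PName.mem_elt (genericPath K X) ⟨q, α⟩ hr

theorem APoset_le {q : SForcing K X} {ξ : Z} {α β : K} (hαβ : α ≤ β) (hα : α ≤ q.η)
    (hβ : β ≤ q.η) (h : ∀ τ ∈ X ξ, (q.f ⟨α, hα⟩ τ).Sub (q.f ⟨β, hβ⟩ τ)) {r : SForcing K X}
    (hr : r ≤ q) : (APoset K X ξ).le (PName.ofOrd β) (PName.ofOrd α) r := by
  refine ⟨fun v _ => ⟨v, le_rfl, ?_⟩, fun v hv => ⟨v, le_rfl, nodeSeqName (q.f ⟨α, hα⟩),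
    fun w hw => ⟨w, le_rfl, nodeSeqName (q.f ⟨β, hβ⟩), ?_, ?_, fun x y hy hx z hz => ?_⟩⟩⟩
  · rcases hαβ.lt_or_eq with h | rfl
    · exact Or.inl (PName.ofOrd_mem h v)
    · exact Or.inr (PName.eq_refl _ _)
  · exact opair_mem_genericPath q ⟨α, hα⟩ (hw.trans (hv.trans hr))
  · exact opair_mem_genericPath q ⟨β, hβ⟩ (hw.trans (hv.trans hr))
  · obtain ⟨v, hv, τ, hτ, e⟩ := PName.mem_ofOrdSet.1 hx z hz
    obtain ⟨w, hw, k⟩ := memSupp_nodeSeqName (h τ hτ) e v le_rfl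
    exact ⟨w, hw.trans hv, k⟩

theorem mem_APoset_carrier {ξ : Z} {x : PName (SForcing K X)} {p : SForcing K X}
    (hx : PName.mem x (APoset K X ξ).carrier p) : ∃ q ≤ p, ∃ α : K, PName.eq x (PName.ofOrd α) q := by
  obtain ⟨q, hq, α, -, e⟩ := PName.mem_ofOrdSet.1 hx p le_rfl
  exact ⟨q, hq, α, e⟩

/-- `β` itself is a common extension. -/
theorem APoset_compat {q : SForcing K X} {ξ : Z} {α β : K} (hαβ : α ≤ β) (hα : α ≤ q.η)
    (hβ : β ≤ q.η) (h : ∀ τ ∈ X ξ, (q.f ⟨α, hα⟩ τ).Sub (q.f ⟨β, hβ⟩ τ)) :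
    (APoset K X ξ).compat (PName.ofOrd α) (PName.ofOrd β) q := fun r hr =>
  ⟨r, le_rfl, PName.ofOrd β, PName.ofOrd_mem_ofType β r, APoset_le hαβ hα hβ h hr,
    APoset_le le_rfl hβ hβ (fun _ _ => Node.Sub.refl _) hr⟩

/-- A poset of the extension has the chain condition if its elements are named by distinct names
`N (w, α)`, apart from fewer than `κ` many exceptions, and if `N (w, α)` and `N (w, β)` are
compatible whenever `f α` and `f β` extend each other on `X (ξ w)`. -/
theorem forced_hasCC [SuccOrder K] [NoMaxOrder K] [LinearOrder Z] [Nonempty Z] [Infinite Θ]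
    (hX : Antitone X) (hcap : ⋂ ξ, X ξ = ∅) (hκ : (#K).IsRegular)
    (hI : ∀ a : K, #(Set.Iic a) < #K) (hpow : ∀ μ : Cardinal.{u}, μ < #K → μ ^ #Θ < #K)
    (hcompl : ∀ ξ, #↥(X ξ)ᶜ = #Θ) (Q : PosetName (SForcing K X)) {W E : Type u}
    (hW : #W < #K) (hE : #E < #K) (ξ : W → Z) (N : (W × K) ⊕ E → PName (SForcing K X))
    (hN : ∀ i j q, PName.eq (N i) (N j) q → i = j)
    (hQ : ∀ p x, PName.mem x Q.carrier p → ∃ q ≤ p, ∃ i, PName.eq x (N i) q)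
    (hcompat : ∀ (q : SForcing K X) (w : W) (α β : K) (hα : α ≤ q.η) (hβ : β ≤ q.η), α ≤ β →
      (∀ τ ∈ X (ξ w), (q.f ⟨α, hα⟩ τ).Sub (q.f ⟨β, hβ⟩ τ)) →
      Q.compat (N (.inl (w, α))) (N (.inl (w, β))) q) :
    Forced (Q.hasCC (PName.ofType K)) := by
  intro p A q _ hA q₁ hq₁
  -- Either some condition bounds the ordinals of the elements of `A`, or above every ordinal
  -- further elements are forced into `A` densely below `q₁`.
  by_cases hb : ∃ r ≤ q₁, ∃ γ, ∀ r' ≤ r, ∀ w α, γ ≤ α → ¬ PName.mem (N (.inl (w, α))) A r'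
  · obtain ⟨r, hr, γ, hγ⟩ := hb
    have hJ : #((W × Set.Iio γ) ⊕ E) < #K := by
      rw [mk_sum, lift_id, lift_id, mk_prod, lift_id, lift_id]
      exact add_lt_of_lt hκ.aleph0_le (mul_lt_of_lt hκ.aleph0_le hW
        ((mk_le_mk_of_subset Set.Iio_subset_Iic_self).trans_lt (hI γ))) hE
    obtain ⟨e⟩ := hJ.le
    obtain ⟨b, hb⟩ := exists_forall_lt_of_mk_lt hκ hI hJ e
    have hcard := PName.cardLT_of_decided (A := A) (p := r)
      (fun i : (W × Set.Iio γ) ⊕ E => N (i.map (Prod.map id Subtype.val) id))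
      (fun i j v h => Sum.map_injective.2 ⟨Function.Injective.prodMap Function.injective_id
        Subtype.val_injective, Function.injective_id⟩ (hN _ _ v h))
      e e.injective b hb (fun v hv x hx => by
        obtain ⟨s, hs, i, hi⟩ := hQ v x (hA.1 x v (hv.trans (hr.trans hq₁)) hx)
        rcases i with ⟨w, α⟩ | i
        · have hα : α < γ := by
            by_contra! h
            exact hγ s (hs.trans hv) w α h (PName.mem_congr_left (PName.mem_mono hx hs) hi)
          exact ⟨s, hs, .inl (w, ⟨α, hα⟩), hi⟩
        · exact ⟨s, hs, .inr i, hi⟩)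
    obtain ⟨s, hs, h⟩ := hcard r le_rfl
    exact ⟨s, hs.trans hr, h⟩
  · exfalso
    push Not at hb
    obtain ⟨r, hr, w, α, β, hα, hβ, hαβ, h1, h2, h3⟩ := SForcing.exists_sub_of_unbounded hX hcap
      hκ hI hpow hcompl hW ξ (fun w α r => PName.mem (N (.inl (w, α))) A r)
      (fun w α s s' hs h => PName.mem_mono h hs) q₁ (fun s hs γ => by
        obtain ⟨r, hr, w, α, h⟩ := hb s hs γ
        exact ⟨r, hr, w, α, h⟩)
    obtain ⟨s, hs, h | h⟩ := hA.2 _ r (hr.trans hq₁) h1 _ r le_rfl h2 r le_rfl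
    · exact hαβ.ne (congrArg Prod.snd (Sum.inl_injective (hN _ _ s h)))
    · refine h s le_rfl (hcompat s w α β (hα.trans hs.1) (hβ.trans hs.1) hαβ.le ?_)
      rw [SForcing.f_eq_of_le hs hα, SForcing.f_eq_of_le hs hβ]
      exact h3

variable [LinearOrder Z] [WellFoundedLT Z]

theorem lottery_carrier_mem {P : Type u} [Preorder P] (Q : Z → PosetName P) (ξ : Z) {x : PName P}
    {p : P} (hx : PName.mem x (Q ξ).carrier p) :
    PName.mem (PName.opair (PName.ofOrd ξ) x) (PosetName.lottery Q).carrier p := by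
  rw [PName.mem_iff] at hx ⊢
  intro q hq
  obtain ⟨r, hr, i, hi, e⟩ := hx q hq
  exact ⟨r, hr, Sum.inl ⟨ξ, i⟩, hi, PName.opair_congr (PName.eq_refl _ _) e⟩

theorem mem_lottery_carrier {P : Type u} [Preorder P] {Q : Z → PosetName P} {x : PName P}
    {p : P} (hx : PName.mem x (PosetName.lottery Q).carrier p) :
    ∃ q ≤ p, PName.eq x PName.empty q ∨ ∃ ξ y, PName.mem y (Q ξ).carrier q ∧
      PName.eq x (PName.opair (PName.ofOrd ξ) y) q := by
  obtain ⟨q, hq, ⟨ξ, i⟩ | i, hi, e⟩ := PName.mem_iff.1 hx p le_rfl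
  · exact ⟨q, hq, Or.inr ⟨ξ, _, PName.mem_elt _ i hi, e⟩⟩
  · exact ⟨q, hq, Or.inl e⟩

theorem lottery_le {P : Type u} [Preorder P] {Q : Z → PosetName P} {ξ : Z} {x y : PName P}
    {p : P} (h : ∀ q ≤ p, (Q ξ).le x y q) : (PosetName.lottery Q).le
      (PName.opair (PName.ofOrd ξ) x) (PName.opair (PName.ofOrd ξ) y) p := by
  intro q hq
  refine ⟨q, le_rfl, Or.inr fun q₁ h₁ => ⟨q₁, le_rfl, ξ, fun q₂ h₂ => ⟨q₂, le_rfl, x,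
    fun q₃ h₃ => ⟨q₃, le_rfl, y, PName.eq_refl _ _, PName.eq_refl _ _, ?_⟩⟩⟩⟩
  exact h q₃ (h₃.trans (h₂.trans (h₁.trans hq)))

end Generic

/-! ### The single posets and their lottery sum -/

theorem lemma3p7 (κ θ : Cardinal.{u}) (hκ : κ.IsRegular) (hθ : θ.IsRegular)
    (hpow : ∀ μ : Cardinal.{u}, μ < κ → μ ^ θ < κ)
    (ζ : Ordinal.{u}) (X : ζ.ToType → Set θ.ord.ToType)
    (hne : ∀ ξ, (X ξ).Nonempty) (hdec : Antitone X)
    (hcompl : ∀ ξ, IsBot ξ → Cardinal.mk ↥(X ξ)ᶜ = θ)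
    (hcap : ⋂ ξ, X ξ = ∅) :
    (∀ ξ : ζ.ToType,
      Forced ((APoset κ.ord.ToType X ξ).hasCC (PName.ofType κ.ord.ToType))) ∧
    ((StrictAnti X ∨ ζ < (Order.succ θ).ord) →
      Forced ((PosetName.lottery fun ξ : ζ.ToType => APoset κ.ord.ToType X ξ).hasCC
        (PName.ofType κ.ord.ToType))) := by
  have hK : #κ.ord.ToType = κ := mk_ord_toType κ
  have hΘ : #θ.ord.ToType = θ := mk_ord_toType θ
  have hθκ : θ < κ := (cantor θ).trans (hpow 2 (hκ.nat_lt 2))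
  have : NoMaxOrder κ.ord.ToType := Cardinal.noMaxOrder hκ.aleph0_le
  let : SuccOrder κ.ord.ToType := SuccOrder.ofLinearWellFoundedLT _
  have : Infinite θ.ord.ToType := infinite_iff.2 (hθ.aleph0_le.trans_eq hΘ.symm)
  have : Nonempty ζ.ToType := by
    by_contra h
    rw [not_nonempty_iff] at h
    rw [Set.iInter_of_empty] at hcap
    exact Set.empty_ne_univ hcap.symm
  have hI := mk_Iic_ord_toType_lt hκ.aleph0_le
  have hreg : (#κ.ord.ToType).IsRegular := by rwa [hK]
  have hpow' : ∀ μ : Cardinal.{u}, μ < #κ.ord.ToType → μ ^ #θ.ord.ToType < #κ.ord.ToType := by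
    rwa [hK, hΘ]
  have hcompl' : ∀ ξ, #↥(X ξ)ᶜ = #θ.ord.ToType := by
    intro ξ
    obtain ⟨b, -, hb⟩ := WellFounded.has_min (wellFounded_lt (α := ζ.ToType)) Set.univ
      ⟨ξ, trivial⟩
    have hb : IsBot b := fun x => not_lt.1 (hb x trivial)
    refine le_antisymm (mk_set_le _) ?_
    exact (hΘ.trans (hcompl b hb).symm).le.trans
      (mk_le_mk_of_subset (Set.compl_subset_compl.2 (hdec (hb ξ))))
  have hone : #PUnit.{u + 1} < #κ.ord.ToType := by
    rw [mk_punit, hK]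
    exact one_lt_aleph0.trans_le hκ.aleph0_le
  refine ⟨fun ξ => ?_, fun h => ?_⟩
  · refine forced_hasCC hdec hcap hreg hI hpow' hcompl' (APoset κ.ord.ToType X ξ)
      (W := PUnit) (E := PEmpty) hone (by rw [mk_pempty]; exact hreg.pos) (fun _ => ξ)
      (Sum.elim (fun i => PName.ofOrd i.2) PEmpty.elim) ?_ ?_ ?_
    · rintro (⟨⟨⟩, α⟩ | i) (⟨⟨⟩, β⟩ | j) q h
      · exact congrArg _ (congrArg _ (PName.ofOrd_inj h))
      · exact j.elim
      · exact i.elim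
      · exact i.elim
    · intro p x hx
      obtain ⟨q, hq, α, e⟩ := mem_APoset_carrier hx
      exact ⟨q, hq, .inl (⟨⟩, α), e⟩
    · exact fun q _ α β hα hβ hαβ h => APoset_compat hαβ hα hβ h
  · have hZ : #ζ.ToType < #κ.ord.ToType := by
      rw [hK]
      refine lt_of_le_of_lt ?_ hθκ
      rcases h with h | h
      -- A point of `X ξ` lost at the next index embeds `ζ` into `θ`. There is no last index, since
      -- its nonempty set would be the intersection.
      · have hex : ∀ ξ, ∃ x ∈ X ξ, ∀ ξ', ξ < ξ' → x ∉ X ξ' := by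
          intro ξ
          by_cases hmax : ∃ ξ', ξ < ξ'
          · obtain ⟨η, hη, hmin⟩ := WellFounded.has_min (wellFounded_lt (α := ζ.ToType))
              {ξ' | ξ < ξ'} hmax
            obtain ⟨x, hx, hx'⟩ := Set.exists_of_ssubset (h hη)
            exact ⟨x, hx, fun ξ' hξ' hx'' => hx' (hdec (not_lt.1 (hmin ξ' hξ')) hx'')⟩
          · push Not at hmax
            obtain ⟨x, hx⟩ := hne ξ
            have : x ∈ ⋂ ξ, X ξ := Set.mem_iInter.2 fun ξ' => hdec (hmax ξ') hx
            rw [hcap] at this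
            exact this.elim
        choose x hx hx' using hex
        rw [← hΘ]
        refine mk_le_of_injective (f := x) fun ξ ξ' e => ?_
        by_contra hne
        rcases lt_or_gt_of_ne hne with hlt | hlt
        · exact hx' ξ ξ' hlt (e ▸ hx ξ')
        · exact hx' ξ' ξ hlt (e ▸ hx ξ)
      · rw [lt_ord] at h
        rw [mk_toType]
        exact Order.le_of_lt_succ h
    -- Fewer than `κ` summands are treated together as `W`; the only exceptional element is the
    -- largest one.
    refine forced_hasCC hdec hcap hreg hI hpow' hcompl' _
      (W := ζ.ToType) (E := PUnit) hZ hone id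
      (Sum.elim (fun i => PName.opair (PName.ofOrd i.1) (PName.ofOrd i.2))
        fun _ => PName.empty) ?_ ?_ ?_
    · rintro (⟨ξ, α⟩ | i) (⟨ξ', β⟩ | j) q h
      · obtain ⟨h1, h2⟩ := PName.opair_inj h
        exact congrArg Sum.inl (Prod.ext (PName.ofOrd_inj h1) (PName.ofOrd_inj h2))
      · exact absurd h (PName.opair_ne_empty _ _ _)
      · exact absurd (PName.eq_symm h) (PName.opair_ne_empty _ _ _)
      · rfl
    · intro p x hx
      obtain ⟨q, hq, e | ⟨ξ, y, hy, e⟩⟩ := mem_lottery_carrier hx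
      · exact ⟨q, hq, .inr ⟨⟩, e⟩
      · obtain ⟨r, hr, α, e'⟩ := mem_APoset_carrier hy
        exact ⟨r, hr.trans hq, .inl (ξ, α), PName.eq_trans (PName.eq_mono e hr)
          (PName.opair_congr (PName.eq_refl _ _) e')⟩
    · intro q ξ α β hα hβ hαβ h r hr
      refine ⟨r, le_rfl, PName.opair (PName.ofOrd ξ) (PName.ofOrd β),
        lottery_carrier_mem _ ξ (PName.ofOrd_mem_ofType β r), ?_, ?_⟩
      · exact lottery_le fun v hv => APoset_le hαβ hα hβ h (hv.trans hr)
      · exact lottery_le fun v hv => APoset_le le_rfl hβ hβ (fun _ _ => Node.Sub.refl _)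
          (hv.trans hr)
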